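/- Let $N,n\ge 1$, and for $i=1,\dots,N$ let $A_i,G_i\in\mathbb R^{n\times n}$ and $c_i\in\mathbb R^{n\times p}$ be such that the pair $(A_i,c_i)$ is observable (for the output $c_i^\top x$), $G_i$ is nonsingular, and the triplet $(A_i,c_i,G_iG_i^\top)$ is regular, i.e. for some $r>0$ the pair $(A_i,Xc_i)$ is controllable, where $X$ is the positive definite solution of $A_iX+XA_i^\top-rXc_ic_i^\top X+G_iG_i^\top=0$. Let $A_{ij}\in\mathbb R^{n\times n}$ for $i\ne j$, and let $r_{\min}>0$ and $\sigma_{\max}>0$. For $\epsilon\in\mathbb R$ let $A$ be the $nN\times nN$ block matrix with diagonal blocks $A_i$ and off-diagonal blocks $\epsilon A_{ij}$, let $G=\operatorname{diag}(G_1,\dots,G_N)$, and for $\gamma$ with $\gamma_i\ge -r_{\min}$ let $c_\gamma=\operatorname{diag}(\sqrt{\gamma_1+r_{\min}}\,c_1,\dots,\sqrt{\gamma_N+r_{\min}}\,c_N)$. Let $\Sigma(\gamma)$ be the positive definite solution of the Riccati equation $$A\Sigma+\Sigma A^\top-\Sigma c_\gamma c_\gamma^\top\Sigma+GG^\top=0,\qquad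 \eta(\gamma)=\operatorname{tr}\Sigma(\gamma).$$ For $\sigma\in[0,\sigma_{\max}]$ let $\operatorname{Sp}[\sigma]=\{v\in\mathbb R^N: v_i\ge 0,\ \sum_i v_i=\sigma\}$, $f(\sigma)=\arg\min_{\gamma\in\operatorname{Sp}[\sigma]}\eta(\gamma)$ and $\mathcal I_\sigma=\{i: f_i(\sigma)>0\}$. Let $\mu_\sigma$ be a number with $\frac{\partial\eta}{\partial\gamma_i}(f(\sigma))=\mu_\sigma$ for $i\in\mathcal I_\sigma$ and $\frac{\partial\eta}{\partial\gamma_j}(f(\sigma))\ge\mu_\sigma$ for $j\notin\mathcal I_\sigma$, let $\mathcal J_\sigma=\{i:\frac{\partial\eta}{\partial\gamma_i}(f(\sigma))=\mu_\sigma\}$, and let $$\mathcal D=\{\sigma\in[0,\sigma_{\max}]:\mathcal I_\sigma\subsetneq\mathcal J_\sigma\}\cup\{0,\sigma_{\max}\}.$$ Then there is $\epsilon_0>0$ such that for all $\epsilon$ with $|\epsilon|\le\epsilon_0$ these objects are well defined (for every $\gamma\in\mathbb R^N$ with nonnegative entries, $\Sigma(\gamma)$ exists and is unique and $\eta$ is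 differentiable at $\gamma$; for every $\sigma\in[0,\sigma_{\max}]$ the minimizer $f(\sigma)$ exists and is unique, and a number $\mu_\sigma$ exists, which is unique for $\sigma>0$), and the following hold: 1. $\mathcal D$ is finite, $\mathcal D=\{\sigma_0,\dots,\sigma_m\}$ with $0=\sigma_0<\sigma_1<\dots<\sigma_m=\sigma_{\max}$. 2. $f$ is continuous and entrywise nondecreasing on $[0,\sigma_{\max}]$, and continuously differentiable on each open interval $(\sigma_{i-1},\sigma_i)$, $i=1,\dots,m$. 3. The map $\sigma\mapsto\mathcal I_\sigma$ is a filtration on $[0,\sigma_{\max}]$, i.e. $\mathcal I_\sigma\subseteq\mathcal I_{\sigma'}$ for $\sigma\le\sigma'$. Moreover $\varnothing=\mathcal I_{\sigma_0}\subsetneq\mathcal I_{\sigma_1}\subsetneq\dots\subsetneq\mathcal I_{\sigma_m}$, and $\mathcal I_\sigma=\mathcal I_{\sigma_i}$ for all $\sigma\in(\sigma_{i-1},\sigma_i]$, $i=1,\dots,m$. -/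

import Mathlib

open Set Matrix

noncomputable section

/-- The Kalman controllability matrix `[B, A B, …, A ^ (n - 1) B]`. -/
def controllabilityMatrix {n p : ℕ} (A : Matrix (Fin n) (Fin n) ℝ)
    (B : Matrix (Fin n) (Fin p) ℝ) : Matrix (Fin n) (Fin n × Fin p) ℝ :=
  Matrix.of fun i kj => (A ^ (kj.1 : ℕ) * B) i kj.2

/-- The pair `(A, B)` of the control system `x' = A x + B u` is controllable. -/
def IsControllable {n p : ℕ} (A : Matrix (Fin n) (Fin n) ℝ)
    (B : Matrix (Fin n) (Fin p) ℝ) : Prop :=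
  (controllabilityMatrix A B).rank = n

/-- The observability matrix, with block rows `cᵀ, cᵀ A, …, cᵀ A ^ (n - 1)`, of `x' = A x`
with output `y = cᵀ x`. -/
def observabilityMatrix {n p : ℕ} (A : Matrix (Fin n) (Fin n) ℝ)
    (c : Matrix (Fin n) (Fin p) ℝ) : Matrix (Fin n × Fin p) (Fin n) ℝ :=
  Matrix.of fun kj i => (cᵀ * A ^ (kj.1 : ℕ)) kj.2 i

/-- The pair `(A, c)`, for the output `y = cᵀ x`, is observable. -/
def IsObservable {n p : ℕ} (A : Matrix (Fin n) (Fin n) ℝ)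
    (c : Matrix (Fin n) (Fin p) ℝ) : Prop :=
  (observabilityMatrix A c).rank = n

/-- `X` is a positive definite solution of the algebraic Riccati equation
`A X + X Aᵀ - X Q X + P = 0`. -/
def IsPosDefRiccatiSolution {ι : Type} [Fintype ι] (A Q P X : Matrix ι ι ℝ) : Prop :=
  X.PosDef ∧ A * X + X * Aᵀ - X * Q * X + P = 0

/-- Regular triplets `(A, c, P)`: `(A, c)` is observable, `P` is positive definite, and for some
`r > 0` the pair `(A, X c)` is controllable, where `X` is the positive definite solution of
`A X + X Aᵀ - r X c cᵀ X + P = 0`. -/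
def IsRegularTriplet {n p : ℕ} (A : Matrix (Fin n) (Fin n) ℝ) (c : Matrix (Fin n) (Fin p) ℝ)
    (P : Matrix (Fin n) (Fin n) ℝ) : Prop :=
  IsObservable A c ∧ P.PosDef ∧
    ∃ r : ℝ, 0 < r ∧ ∃ X : Matrix (Fin n) (Fin n) ℝ,
      IsPosDefRiccatiSolution A (r • (c * cᵀ)) P X ∧ IsControllable A (X * c)

/-- Data of a network of `N` linear systems of dimension `n` with outputs of dimension `p`:
`dxᵢ = (Aᵢ xᵢ + ε ∑_{j ≠ i} Aᵢⱼ xⱼ) dt + Gᵢ dwᵢ`, observed through `cᵢᵀ xᵢ`.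
The diagonal matrices `coupling i i` are never used. -/
structure Network (N n p : ℕ) where
  /-- the matrices `Aᵢ` -/
  A : Fin N → Matrix (Fin n) (Fin n) ℝ
  /-- the matrices `Aᵢⱼ`, for `i ≠ j` -/
  coupling : Fin N → Fin N → Matrix (Fin n) (Fin n) ℝ
  /-- the matrices `cᵢ` -/
  c : Fin N → Matrix (Fin n) (Fin p) ℝ
  /-- the matrices `Gᵢ` -/
  G : Fin N → Matrix (Fin n) (Fin n) ℝ

namespace Network

variable {N n p : ℕ}

/-- Every `(Aᵢ, cᵢ)` is observable, every `Gᵢ` is nonsingular, and every triplet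
`(Aᵢ, cᵢ, Gᵢ Gᵢᵀ)` is regular. -/
def IsAdmissible (S : Network N n p) : Prop :=
  ∀ i, IsObservable (S.A i) (S.c i) ∧ IsUnit (S.G i) ∧
    IsRegularTriplet (S.A i) (S.c i) (S.G i * (S.G i)ᵀ)

/-- The network drift matrix, with diagonal blocks `Aᵢ` and off-diagonal blocks `ε Aᵢⱼ`.
The second component of an index is the number of the subsystem. -/
def drift (S : Network N n p) (ε : ℝ) : Matrix (Fin n × Fin N) (Fin n × Fin N) ℝ :=
  Matrix.of fun a b =>
    if a.2 = b.2 then S.A a.2 a.1 b.1 else ε * S.coupling a.2 b.2 a.1 b.1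

/-- `G = diag(G₁, …, G_N)`. -/
def noise (S : Network N n p) : Matrix (Fin n × Fin N) (Fin n × Fin N) ℝ :=
  Matrix.blockDiagonal S.G

/-- `c_γ = diag(√(γ₁ + r_min) c₁, …, √(γ_N + r_min) c_N)`. -/
def obs (S : Network N n p) (rmin : ℝ) (γ : Fin N → ℝ) :
    Matrix (Fin n × Fin N) (Fin p × Fin N) ℝ :=
  Matrix.blockDiagonal fun i => Real.sqrt (γ i + rmin) • S.c i

/-- `X` is a positive definite solution of the network Riccati equation
`A X + X Aᵀ - X c_γ c_γᵀ X + G Gᵀ = 0`. -/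
def IsCovariance (S : Network N n p) (ε rmin : ℝ) (γ : Fin N → ℝ)
    (X : Matrix (Fin n × Fin N) (Fin n × Fin N) ℝ) : Prop :=
  IsPosDefRiccatiSolution (S.drift ε) (S.obs rmin γ * (S.obs rmin γ)ᵀ)
    (S.noise * S.noiseᵀ) X

/-- The steady-state error covariance `Σ(γ)`: the positive definite solution of the network
Riccati equation. -/
def covariance (S : Network N n p) (ε rmin : ℝ) (γ : Fin N → ℝ) :
    Matrix (Fin n × Fin N) (Fin n × Fin N) ℝ :=
  Classical.epsilon (S.IsCovariance ε rmin γ)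

/-- The estimation error `η(γ) = tr Σ(γ)`. -/
def error (S : Network N n p) (ε rmin : ℝ) (γ : Fin N → ℝ) : ℝ :=
  (S.covariance ε rmin γ).trace

/-- The partial derivative `∂η/∂γᵢ` at `γ`. -/
def errorPartial (S : Network N n p) (ε rmin : ℝ) (γ : Fin N → ℝ) (i : Fin N) : ℝ :=
  deriv (fun t : ℝ => S.error ε rmin (Function.update γ i t)) (γ i)

end Network

/-- The simplex of height `σ` in `ℝ^N`. -/
def heightSimplex (N : ℕ) (σ : ℝ) : Set (Fin N → ℝ) :=
  {v | (∀ i, 0 ≤ v i) ∧ ∑ i, v i = σ}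

namespace Network

variable {N n p : ℕ}

/-- `γ` minimizes `η` over the simplex of height `σ`. -/
def IsOptimal (S : Network N n p) (ε rmin σ : ℝ) (γ : Fin N → ℝ) : Prop :=
  γ ∈ heightSimplex N σ ∧ IsMinOn (S.error ε rmin) (heightSimplex N σ) γ

/-- The optimal allocation map `f`, `f(σ) = argmin η` over the simplex of height `σ`. -/
def alloc (S : Network N n p) (ε rmin σ : ℝ) : Fin N → ℝ :=
  Classical.epsilon (S.IsOptimal ε rmin σ)

/-- The support `I_σ = {i | f_i(σ) > 0}` of the optimal allocation. -/
def supp (S : Network N n p) (ε rmin σ : ℝ) : Set (Fin N) :=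
  {i | 0 < S.alloc ε rmin σ i}

/-- `μ` is a multiplier at `σ`: at `f(σ)` one has `∂η/∂γᵢ = μ` for `i ∈ I_σ` and
`∂η/∂γⱼ ≥ μ` for `j ∉ I_σ`. (It is unique when `I_σ` is nonempty, that is, when `σ > 0`.) -/
def IsMultiplier (S : Network N n p) (ε rmin σ μ : ℝ) : Prop :=
  (∀ i ∈ S.supp ε rmin σ, S.errorPartial ε rmin (S.alloc ε rmin σ) i = μ) ∧
    ∀ j ∉ S.supp ε rmin σ, μ ≤ S.errorPartial ε rmin (S.alloc ε rmin σ) j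

/-- The set `J_σ` of the indices `i` with `∂η/∂γᵢ = μ` at `f(σ)`, where `μ` is the multiplier. -/
def tight (S : Network N n p) (ε rmin σ μ : ℝ) : Set (Fin N) :=
  {i | S.errorPartial ε rmin (S.alloc ε rmin σ) i = μ}

/-- The set of breakpoints `{σ ∈ [0, σ_max] | I_σ ⊊ J_σ} ∪ {0, σ_max}`. -/
def breakpoints (S : Network N n p) (ε rmin σmax : ℝ) : Set ℝ :=
  {σ | σ ∈ Icc 0 σmax ∧
    ∃ μ, S.IsMultiplier ε rmin σ μ ∧ S.supp ε rmin σ ⊂ S.tight ε rmin σ μ} ∪ {0, σmax}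

end Network

end

/-! ### Positive definite matrices -/

section PosDefLemmas

variable {ι : Type}

/-! With `Y = Σ⁻¹`, `P = G Gᵀ` and `Q = c_γ c_γᵀ`, the Riccati equation becomes `Y A + Aᵀ Y + Y P Y
= Q`, where the allocation enters only through the right-hand side, and affinely. The linearization
at a solution is `E ↦ E K + Kᵀ E` with `K = A + P Y`, and `Y` itself certifies that `K` is
antistable, because `Y K + Kᵀ Y = Q + Y P Y` is positive definite. Hence the linearization is
injective (`sylvester_injective`). This yields uniqueness, smooth dependence on the data by the
inverse function theorem and, with an a priori bound, existence by continuation.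

For a single system observed with intensity `t`, differentiating the equation twice shows that `Y`
is concave in `t` and that `tr Y⁻¹` has positive second derivative (`deriv_deriv_trace_inv_pos`). At
`ε = 0` the error is a sum of such functions, one for each `γ i`, so its Hessian is diagonal and
positive. By continuity in `(ε, γ)` and compactness of the cube, for small `ε` the Hessian is
diagonally dominant on the cube, with a margin proportional to `N`.

The rest uses only this dominance and the first order conditions. If two optimality points have
heights `σ ≤ σ'`, complementary slackness and dominance force their difference to be entrywise
nonnegative (`IsNearDiagonal.kkt_comparison`). This gives uniqueness, monotonicity and Lipschitz
continuity of the allocation. The strict part of the comparison shows that a tight index is active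
at every larger height, so the support grows strictly after each breakpoint and there are finitely
many of them. Conversely, by continuity, an index can enter only at a breakpoint. Between
breakpoints the support is constant, and the optimality conditions are a square system with
invertible Jacobian. -/

theorem Matrix.PosDef.transpose_eq {M : Matrix ι ι ℝ} (h : M.PosDef) : Mᵀ = M := by
  simpa [conjTranspose_eq_transpose_of_trivial] using h.isHermitian.eq

theorem Matrix.PosSemidef.transpose_eq {M : Matrix ι ι ℝ} (h : M.PosSemidef) : Mᵀ = M := by
  simpa [conjTranspose_eq_transpose_of_trivial] using h.isHermitian.eq

variable [Fintype ι]

theorem posSemidef_iff_real {M : Matrix ι ι ℝ} :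
    M.PosSemidef ↔ Mᵀ = M ∧ ∀ v, 0 ≤ v ⬝ᵥ M *ᵥ v := by
  rw [posSemidef_iff_dotProduct_mulVec]
  simp [IsHermitian, conjTranspose_eq_transpose_of_trivial]

theorem posDef_iff_real {M : Matrix ι ι ℝ} :
    M.PosDef ↔ Mᵀ = M ∧ ∀ v, v ≠ 0 → 0 < v ⬝ᵥ M *ᵥ v := by
  rw [posDef_iff_dotProduct_mulVec]
  simp [IsHermitian, conjTranspose_eq_transpose_of_trivial]

theorem Matrix.PosSemidef.mulVec_eq_zero {M : Matrix ι ι ℝ} (h : M.PosSemidef) {v : ι → ℝ}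
    (hv : v ⬝ᵥ M *ᵥ v = 0) : M *ᵥ v = 0 :=
  (h.dotProduct_mulVec_zero_iff v).1 (by simpa using hv)

/-- Cyclicity turns the trace into the squared Frobenius norm of `B * E * Cᵀ`, from which
nonnegativity and definiteness follow. -/
theorem trace_transpose_mul_mul_mul_eq (B C E : Matrix ι ι ℝ) :
    (Eᵀ * (Bᵀ * B) * E * (Cᵀ * C)).trace = ((B * E * Cᵀ)ᵀ * (B * E * Cᵀ)).trace := by
  rw [← Matrix.mul_assoc, trace_mul_comm]
  simp only [transpose_mul, transpose_transpose, Matrix.mul_assoc]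

variable [DecidableEq ι]

open scoped MatrixOrder in
theorem Matrix.PosSemidef.exists_eq_transpose_mul_self {M : Matrix ι ι ℝ} (h : M.PosSemidef) :
    ∃ B : Matrix ι ι ℝ, M = Bᵀ * B := by
  obtain ⟨B, rfl⟩ := CStarAlgebra.nonneg_iff_eq_star_mul_self.mp h.nonneg
  exact ⟨B, by rw [star_eq_conjTranspose, conjTranspose_eq_transpose_of_trivial]⟩

theorem Matrix.PosDef.exists_eq_transpose_mul_self {M : Matrix ι ι ℝ} (h : M.PosDef) :
    ∃ B : Matrix ι ι ℝ, IsUnit B ∧ M = Bᵀ * B := by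
  obtain ⟨B, hB⟩ := h.posSemidef.exists_eq_transpose_mul_self
  refine ⟨B, ?_, hB⟩
  have := h.isUnit
  rw [hB, isUnit_iff_isUnit_det, det_mul, det_transpose] at this
  rw [isUnit_iff_isUnit_det]
  exact isUnit_of_mul_isUnit_left this

theorem trace_transpose_mul_mul_mul_nonneg {M R : Matrix ι ι ℝ} (hM : M.PosSemidef)
    (hR : R.PosSemidef) (E : Matrix ι ι ℝ) : 0 ≤ (Eᵀ * M * E * R).trace := by
  obtain ⟨B, rfl⟩ := hM.exists_eq_transpose_mul_self
  obtain ⟨C, rfl⟩ := hR.exists_eq_transpose_mul_self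
  rw [trace_transpose_mul_mul_mul_eq, ← conjTranspose_eq_transpose_of_trivial]
  exact (posSemidef_conjTranspose_mul_self _).trace_nonneg

theorem eq_zero_of_trace_transpose_mul_mul_mul_eq_zero {M R : Matrix ι ι ℝ} (hM : M.PosDef)
    (hR : R.PosDef) {E : Matrix ι ι ℝ} (h : (Eᵀ * M * E * R).trace = 0) : E = 0 := by
  obtain ⟨B, hB, rfl⟩ := hM.exists_eq_transpose_mul_self
  obtain ⟨C, hC, rfl⟩ := hR.exists_eq_transpose_mul_self
  rw [trace_transpose_mul_mul_mul_eq, ← conjTranspose_eq_transpose_of_trivial,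
    trace_conjTranspose_mul_self_eq_zero_iff] at h
  have hC' : IsUnit Cᵀ := (isUnit_transpose C).2 hC
  rw [hC'.mul_left_eq_zero, hB.mul_right_eq_zero] at h
  exact h

/-- Injectivity of the Sylvester operator `E ↦ E K₂ + K₁ᵀ E` when `Kᵢ` is antistable with Lyapunov
certificate `Yᵢ`. -/
theorem sylvester_injective {Y₁ Y₂ K₁ K₂ E : Matrix ι ι ℝ} (hY₁ : Y₁.PosDef) (hY₂ : Y₂.PosDef)
    (hR₁ : (Y₁ * K₁ + K₁ᵀ * Y₁).PosDef) (hR₂ : (Y₂ * K₂ + K₂ᵀ * Y₂).PosDef)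
    (h : E * K₂ + K₁ᵀ * E = 0) : E = 0 := by
  -- Pairing the equation with `Z` gives half the sum of two nonnegative traces, weighted by the two
  -- Lyapunov forms. Both therefore vanish, and one of them already forces `Z = 0`.
  set Z := Y₁⁻¹ * E * Y₂⁻¹ with hZ
  have hE : E = Y₁ * Z * Y₂ := by
    have h1 : Y₁ * Y₁⁻¹ = 1 := mul_nonsing_inv _ ((isUnit_iff_isUnit_det _).1 hY₁.isUnit)
    have h2 : Y₂⁻¹ * Y₂ = 1 := nonsing_inv_mul _ ((isUnit_iff_isUnit_det _).1 hY₂.isUnit)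
    rw [hZ, Matrix.mul_assoc, Matrix.mul_assoc, h2, Matrix.mul_one, ← Matrix.mul_assoc, h1,
      Matrix.one_mul]
  have e1 : (Zᵀ * Y₁ * Z * (Y₂ * K₂ + K₂ᵀ * Y₂)).trace = 2 * (Zᵀ * Y₁ * Z * (Y₂ * K₂)).trace := by
    rw [Matrix.mul_add, trace_add, two_mul, add_right_inj, ← trace_transpose]
    simp only [transpose_mul, transpose_transpose, hY₁.transpose_eq, hY₂.transpose_eq]
    rw [trace_mul_comm]
    simp only [Matrix.mul_assoc]
  have e2 : (Zᵀ * (Y₁ * K₁ + K₁ᵀ * Y₁) * Z * Y₂).trace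
      = 2 * (Zᵀ * (K₁ᵀ * Y₁) * Z * Y₂).trace := by
    rw [Matrix.mul_add, Matrix.add_mul, Matrix.add_mul, trace_add, two_mul, add_left_inj,
      ← trace_transpose]
    simp only [transpose_mul, transpose_transpose, hY₁.transpose_eq, hY₂.transpose_eq]
    rw [trace_mul_comm]
    simp only [Matrix.mul_assoc]
  have e3 : (Zᵀ * Y₁ * Z * (Y₂ * K₂)).trace + (Zᵀ * (K₁ᵀ * Y₁) * Z * Y₂).trace = 0 := by
    have : (Zᵀ * (E * K₂ + K₁ᵀ * E)).trace = 0 := by rw [h]; simp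
    rw [← this, hE, ← trace_add, Matrix.mul_add]
    simp only [Matrix.mul_assoc]
  have p1 := trace_transpose_mul_mul_mul_nonneg hY₁.posSemidef hR₂.posSemidef Z
  have p2 := trace_transpose_mul_mul_mul_nonneg hR₁.posSemidef hY₂.posSemidef Z
  have hZ0 := eq_zero_of_trace_transpose_mul_mul_mul_eq_zero hY₁ hR₂ (E := Z) (by linarith)
  rw [hE, hZ0]; simp

end PosDefLemmas

/-! ### Compactness of the unit sphere and Lyapunov inequalities -/

section Compactness

variable {ι : Type} [Fintype ι]

theorem exists_smul_mem_sphere {v : ι → ℝ} (hv : v ≠ 0) :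
    ‖v‖⁻¹ • v ∈ Metric.sphere (0 : ι → ℝ) 1 := by
  simp [norm_smul, norm_ne_zero_iff.2 hv]

theorem dotProduct_mulVec_smul (M : Matrix ι ι ℝ) (a : ℝ) (v : ι → ℝ) :
    (a • v) ⬝ᵥ M *ᵥ (a • v) = a ^ 2 * (v ⬝ᵥ M *ᵥ v) := by
  rw [mulVec_smul, smul_dotProduct, dotProduct_smul]; simp only [smul_eq_mul]; ring

theorem pos_of_pos_on_sphere {M : Matrix ι ι ℝ}
    (h : ∀ v ∈ Metric.sphere (0 : ι → ℝ) 1, 0 < v ⬝ᵥ M *ᵥ v) {v : ι → ℝ} (hv : v ≠ 0) :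
    0 < v ⬝ᵥ M *ᵥ v := by
  have := h _ (exists_smul_mem_sphere hv)
  rw [dotProduct_mulVec_smul] at this
  exact pos_of_mul_pos_right this (by positivity)

/-- Positive definite matrices form an open subset of the symmetric ones. -/
theorem Matrix.PosDef.eventually_posDef {Y : Matrix ι ι ℝ} (hY : Y.PosDef) :
    ∀ᶠ Z in nhds Y, Zᵀ = Z → Z.PosDef := by
  have hc : Continuous fun q : Matrix ι ι ℝ × (ι → ℝ) => q.2 ⬝ᵥ (q.1 *ᵥ q.2) := by fun_prop
  have := (isCompact_sphere (0 : ι → ℝ) 1).eventually_forall_of_forall_eventually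
    (x₀ := Y) (P := fun Z v => 0 < v ⬝ᵥ Z *ᵥ v) (fun v hv =>
      hc.continuousAt.eventually (lt_mem_nhds ((posDef_iff_real.1 hY).2 v (by
        rintro rfl; simp at hv))))
  filter_upwards [this] with Z hZ hsymm
  exact posDef_iff_real.2 ⟨hsymm, fun v hv => pos_of_pos_on_sphere hZ hv⟩

/-- The minimal generalized eigenvalue of a symmetric pencil `(Z, Y)` with `Y` positive definite. -/
theorem exists_min_generalized_eigenvalue [Nonempty ι] {Y Z : Matrix ι ι ℝ} (hY : Y.PosDef)
    (hZ : Zᵀ = Z) :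
    ∃ (l : ℝ) (v : ι → ℝ), v ≠ 0 ∧ (Z - l • Y).PosSemidef ∧ Z *ᵥ v = l • Y *ᵥ v := by
  have hpos : ∀ v ∈ Metric.sphere (0 : ι → ℝ) 1, 0 < v ⬝ᵥ Y *ᵥ v := fun v hv =>
    (posDef_iff_real.1 hY).2 v (by rintro rfl; simp at hv)
  have hne : (Metric.sphere (0 : ι → ℝ) 1).Nonempty := NormedSpace.sphere_nonempty.2 zero_le_one
  -- The Rayleigh quotient is homogeneous of degree 0, so its minimum over the sup-norm sphere is
  -- global.
  obtain ⟨v, hv, hmin⟩ := (isCompact_sphere (0 : ι → ℝ) 1).exists_isMinOn hne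
    (f := fun v => (v ⬝ᵥ Z *ᵥ v) / (v ⬝ᵥ Y *ᵥ v)) (by
      apply ContinuousOn.div (by fun_prop) (by fun_prop)
      exact fun v hv => (hpos v hv).ne')
  set l := (v ⬝ᵥ Z *ᵥ v) / (v ⬝ᵥ Y *ᵥ v) with hl
  have hps : (Z - l • Y).PosSemidef := by
    refine posSemidef_iff_real.2 ⟨by simp [hZ, hY.transpose_eq], fun w => ?_⟩
    by_cases hw : w = 0
    · simp [hw]
    have hw' := exists_smul_mem_sphere hw
    have h1 : l ≤ _ := hmin hw'
    rw [le_div_iff₀ (hpos _ hw'), dotProduct_mulVec_smul, dotProduct_mulVec_smul] at h1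
    have h2 : 0 < (‖w‖⁻¹) ^ 2 := by have := norm_pos_iff.2 hw; positivity
    rw [sub_mulVec, dotProduct_sub, smul_mulVec, dotProduct_smul, smul_eq_mul]
    nlinarith [h1]
  refine ⟨l, v, by rintro rfl; simp at hv, hps, ?_⟩
  have h0 := hps.mulVec_eq_zero (v := v) (by
    rw [sub_mulVec, dotProduct_sub, smul_mulVec, dotProduct_smul, smul_eq_mul, hl,
      div_mul_cancel₀ _ (hpos v hv).ne', sub_self])
  rw [sub_mulVec, smul_mulVec, sub_eq_zero] at h0
  exact h0

/-- Solutions of a Lyapunov equation with antistable coefficient and positive semidefinite right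
hand side are positive semidefinite. -/
theorem lyapunov_posSemidef {Y K Z : Matrix ι ι ℝ} (hY : Y.PosDef)
    (hR : (Y * K + Kᵀ * Y).PosDef) (hZ : Zᵀ = Z) (hS : (Z * K + Kᵀ * Z).PosSemidef) :
    Z.PosSemidef := by
  cases isEmpty_or_nonempty ι
  · exact posSemidef_iff_real.2 ⟨hZ, fun v => by simp⟩
  obtain ⟨l, v, hv, hps, hlv⟩ := exists_min_generalized_eigenvalue hY hZ
  have key : ∀ W : Matrix ι ι ℝ, Wᵀ = W →
      v ⬝ᵥ (W * K + Kᵀ * W) *ᵥ v = 2 * ((W *ᵥ v) ⬝ᵥ K *ᵥ v) := by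
    intro W hW
    have h1 : v ⬝ᵥ (W * K) *ᵥ v = (W *ᵥ v) ⬝ᵥ K *ᵥ v := by
      rw [← mulVec_mulVec, dotProduct_mulVec, ← mulVec_transpose, hW]
    have h2 : v ⬝ᵥ (Kᵀ * W) *ᵥ v = (W *ᵥ v) ⬝ᵥ K *ᵥ v := by
      rw [← mulVec_mulVec, dotProduct_mulVec, vecMul_transpose, dotProduct_comm]
    rw [add_mulVec, dotProduct_add, h1, h2, two_mul]
  -- Since `Z v = l Y v`, the form of `Z K + Kᵀ Z` at `v` is `l` times that of `Y K + Kᵀ Y`, which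
  -- is positive. Then `Z = (Z - l Y) + l Y` is a sum of positive semidefinite matrices.
  have hl : 0 ≤ l := by
    have h1 := (posSemidef_iff_real.1 hS).2 v
    have h2 := (posDef_iff_real.1 hR).2 v hv
    rw [key Z hZ, hlv, smul_dotProduct, smul_eq_mul] at h1
    rw [key Y hY.transpose_eq] at h2
    by_contra! hlt
    nlinarith
  have := hps.add (hY.posSemidef.smul hl)
  simpa using this

end Compactness

/-! ### The Riccati equation in information form -/

section Riccati

variable {ι : Type} [Fintype ι]

/-- `Y` is a positive definite solution of the information form `Y A + Aᵀ Y + Y P Y = Q` of the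
Riccati equation; its inverse solves the covariance form. -/
def IsInfoSolution (A Q P Y : Matrix ι ι ℝ) : Prop :=
  Y.PosDef ∧ Y * A + Aᵀ * Y + Y * P * Y = Q

/-- By the equation, the Lyapunov form of `Y` along `A + P * Y` is `Q + Y P Y`: a solution certifies
antistability of its own linearization. -/
theorem IsInfoSolution.lyapunov_posDef {A Q P Y : Matrix ι ι ℝ} (h : IsInfoSolution A Q P Y)
    (hP : P.PosDef) (hQ : Q.PosSemidef) : (Y * (A + P * Y) + (A + P * Y)ᵀ * Y).PosDef := by
  classical
  have e : Y * (A + P * Y) + (A + P * Y)ᵀ * Y = Q + Yᵀ * P * Y := by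
    rw [← h.2, transpose_add, transpose_mul, hP.transpose_eq, h.1.transpose_eq]
    noncomm_ring
  rw [e]
  refine (hP.conjTranspose_mul_mul_same (B := Y) ?_).posSemidef_add hQ
  exact mulVec_injective_iff_isUnit.2 h.1.isUnit

theorem isClosed_posSemidef : IsClosed {Y : Matrix ι ι ℝ | Y.PosSemidef} := by
  simp only [posSemidef_iff_real, ofPred_and, ofPred_forall]
  refine (isClosed_eq (by fun_prop) (by fun_prop)).inter (isClosed_iInter fun v => ?_)
  exact isClosed_le (by fun_prop) (by fun_prop)

variable [DecidableEq ι]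

/-- The difference `E` of two solutions satisfies `E K₂ + K₁ᵀ E = 0` exactly, with `Kᵢ = A + P Yᵢ`;
hence the need for two certificates in `sylvester_injective`. -/
theorem IsInfoSolution.unique {A Q P Y₁ Y₂ : Matrix ι ι ℝ} (hP : P.PosDef) (hQ : Q.PosSemidef)
    (h₁ : IsInfoSolution A Q P Y₁) (h₂ : IsInfoSolution A Q P Y₂) : Y₁ = Y₂ := by
  rw [← sub_eq_zero]
  refine sylvester_injective h₁.1 h₂.1 (h₁.lyapunov_posDef hP hQ) (h₂.lyapunov_posDef hP hQ) ?_
  have := sub_eq_zero.2 (h₁.2.trans h₂.2.symm)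
  rw [← this, transpose_add, transpose_mul, hP.transpose_eq, h₁.1.transpose_eq]
  noncomm_ring

theorem isPosDefRiccatiSolution_iff {A Q P X : Matrix ι ι ℝ} :
    IsPosDefRiccatiSolution A Q P X ↔ X.PosDef ∧ IsInfoSolution A Q P X⁻¹ := by
  refine and_congr_right fun hX => ?_
  have hu := (isUnit_iff_isUnit_det _).1 hX.isUnit
  have h1 : X * X⁻¹ = 1 := mul_nonsing_inv _ hu
  have h2 : X⁻¹ * X = 1 := nonsing_inv_mul _ hu
  rw [IsInfoSolution, and_iff_right hX.inv]
  constructor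
  · intro h
    have : X⁻¹ * (A * X + X * Aᵀ - X * Q * X + P) * X⁻¹ = 0 := by rw [h]; simp
    simp only [Matrix.mul_add, Matrix.add_mul, Matrix.mul_sub, Matrix.sub_mul, Matrix.mul_assoc, h1,
      Matrix.mul_one] at this
    simp only [← Matrix.mul_assoc, h2, Matrix.one_mul] at this
    rw [← sub_eq_zero, ← this]; abel
  · intro h
    have : X * (X⁻¹ * A + Aᵀ * X⁻¹ + X⁻¹ * P * X⁻¹) * X = X * Q * X := by rw [h]
    simp only [Matrix.mul_add, Matrix.add_mul, Matrix.mul_assoc, h2, Matrix.mul_one] at this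
    simp only [← Matrix.mul_assoc, h1, Matrix.one_mul] at this
    rw [← this]; abel

open scoped Matrix.Norms.Operator ContDiff

/-- The polynomial map whose local inverses are the solution maps of the Riccati equation. -/
def riccatiMap (P : Matrix ι ι ℝ) (z : Matrix ι ι ℝ × Matrix ι ι ℝ) :
    Matrix ι ι ℝ × Matrix ι ι ℝ :=
  (z.1, z.2 * z.1 + z.1ᵀ * z.2 + z.2 * P * z.2)

/-- Transposition as a continuous linear map. -/
noncomputable def transposeCLM (ι : Type) [Fintype ι] [DecidableEq ι] : Matrix ι ι ℝ →L[ℝ] Matrix ι ι ℝ :=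
  LinearMap.toContinuousLinearMap (transposeLinearEquiv ι ι ℝ ℝ).toLinearMap

theorem contDiff_riccatiMap (P : Matrix ι ι ℝ) : ContDiff ℝ ∞ (riccatiMap P) := by
  have : riccatiMap P = fun z => (z.1, z.2 * z.1 + transposeCLM ι z.1 * z.2 + z.2 * P * z.2) := rfl
  rw [this]
  fun_prop

/-- The derivative of `riccatiMap` at `(A, Y)`. -/
def riccatiMapDeriv (P A Y : Matrix ι ι ℝ) :
    (Matrix ι ι ℝ × Matrix ι ι ℝ) →ₗ[ℝ] (Matrix ι ι ℝ × Matrix ι ι ℝ) where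
  toFun z := (z.1, (Y * z.1 + z.2 * A) + (Aᵀ * z.2 + z.1ᵀ * Y) + (Y * P * z.2 + z.2 * P * Y))
  map_add' z w := by
    ext1
    · rfl
    · simp only [Prod.fst_add, Prod.snd_add, transpose_add]; noncomm_ring
  map_smul' a z := by
    ext1
    · rfl
    · simp [smul_add]

theorem hasFDerivAt_riccatiMap (P A Y : Matrix ι ι ℝ) :
    HasFDerivAt (riccatiMap P) (riccatiMapDeriv P A Y).toContinuousLinearMap (A, Y) := by
  have hf : HasFDerivAt (fun z : Matrix ι ι ℝ × Matrix ι ι ℝ => z.1)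
    (ContinuousLinearMap.fst ℝ _ _) (A, Y) := hasFDerivAt_fst
  have hs : HasFDerivAt (fun z : Matrix ι ι ℝ × Matrix ι ι ℝ => z.2)
    (ContinuousLinearMap.snd ℝ _ _) (A, Y) := hasFDerivAt_snd
  have ht : HasFDerivAt (fun z : Matrix ι ι ℝ × Matrix ι ι ℝ => z.1ᵀ)
    ((transposeCLM ι).comp (ContinuousLinearMap.fst ℝ _ _)) (A, Y) :=
    (transposeCLM ι).hasFDerivAt.comp (A, Y) hf
  have hsP : HasFDerivAt (fun z : Matrix ι ι ℝ × Matrix ι ι ℝ => z.2 * P) _ (A, Y) :=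
    hs.mul_const' P
  refine (hf.prodMk (((hs.mul' hf).add (ht.mul' hs)).add (hsP.mul' hs))).congr_fderiv ?_
  -- The summands of `riccatiMapDeriv` are grouped as the product rule produces them, so the two
  -- maps agree definitionally.
  exact ContinuousLinearMap.ext fun z => rfl

/-- Near a positive definite solution the Riccati equation has a smooth family of positive definite
solutions. -/
theorem IsInfoSolution.exists_contDiffAt {A Q P Y : Matrix ι ι ℝ} (hP : P.PosDef)
    (hQ : Q.PosSemidef) (h : IsInfoSolution A Q P Y) :
    ∃ ψ : Matrix ι ι ℝ × Matrix ι ι ℝ → Matrix ι ι ℝ, ψ (A, Q) = Y ∧ ContDiffAt ℝ ∞ ψ (A, Q) ∧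
      ∀ᶠ z in nhds (A, Q), z.2ᵀ = z.2 → IsInfoSolution z.1 z.2 P (ψ z) := by
  -- Keeping `A` as first component makes the inverse function theorem serve as an implicit one: on
  -- the kernel only the Sylvester operator remains.
  have hinj : Function.Injective (riccatiMapDeriv P A Y) := by
    refine (injective_iff_map_eq_zero _).2 fun z hz => ?_
    have hz1 : z.1 = 0 := congrArg Prod.fst hz
    have hz2 : (Y * z.1 + z.2 * A) + (Aᵀ * z.2 + z.1ᵀ * Y) + (Y * P * z.2 + z.2 * P * Y) = 0 :=
      congrArg Prod.snd hz
    rw [hz1] at hz2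
    refine Prod.ext hz1 (sylvester_injective h.1 h.1 (h.lyapunov_posDef hP hQ)
      (h.lyapunov_posDef hP hQ) ?_)
    rw [← hz2, transpose_add, transpose_mul, hP.transpose_eq, h.1.transpose_eq]
    simp only [Matrix.mul_zero, transpose_zero, Matrix.zero_mul]
    noncomm_ring
  set L := (LinearEquiv.ofInjectiveEndo _ hinj).toContinuousLinearEquiv
  have hL : HasFDerivAt (riccatiMap P) (L : _ →L[ℝ] _) (A, Y) := hasFDerivAt_riccatiMap P A Y
  have hC : ContDiffAt ℝ ∞ (riccatiMap P) (A, Y) := (contDiff_riccatiMap P).contDiffAt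
  have hne : (∞ : WithTop ℕ∞) ≠ 0 := by simp
  have hS := hC.hasStrictFDerivAt' hL hne
  have hval : riccatiMap P (A, Y) = (A, Q) := Prod.ext rfl h.2
  set φ := hC.localInverse hL hne
  have hφ : ContDiffAt ℝ ∞ φ (A, Q) := hval ▸ hC.to_localInverse hL hne
  have hleft : ∀ᶠ z in nhds (A, Y), φ (riccatiMap P z) = z := hS.eventually_left_inverse
  have hright : ∀ᶠ z in nhds (A, Q), riccatiMap P (φ z) = z := hval ▸ hS.eventually_right_inverse
  have hφv : φ (A, Q) = (A, Y) := by rw [← hval]; exact hleft.self_of_nhds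
  refine ⟨fun z => (φ z).2, congrArg Prod.snd hφv, contDiff_snd.contDiffAt.comp _ hφ, ?_⟩
  have hφc : Filter.Tendsto φ (nhds (A, Q)) (nhds (A, Y)) := hφv ▸ hφ.continuousAt
  have hY : Filter.Tendsto (fun z => (φ z).2) (nhds (A, Q)) (nhds Y) :=
    (continuous_snd.tendsto (A, Y)).comp hφc
  -- The local inverse need not be symmetric a priori. Its transpose has the same image and also
  -- lies near `Y`, so local injectivity makes the two equal.
  have htr : Filter.Tendsto (fun z => ((φ z).1, (φ z).2ᵀ)) (nhds (A, Q)) (nhds (A, Y)) := by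
    have hc : Continuous fun z : Matrix ι ι ℝ × Matrix ι ι ℝ => (z.1, z.2ᵀ) := by fun_prop
    have := (hc.tendsto (A, Y)).comp hφc
    simp only [h.1.transpose_eq] at this
    exact this
  filter_upwards [hright, htr.eventually hleft, hY.eventually h.1.eventually_posDef]
    with z h1 h2 h3 hsymm
  have e1 : (φ z).1 = z.1 := (congrArg Prod.fst h1 :)
  have e2 : (φ z).2 * (φ z).1 + (φ z).1ᵀ * (φ z).2 + (φ z).2 * P * (φ z).2 = z.2 :=
    (congrArg Prod.snd h1 :)
  have e3 : riccatiMap P ((φ z).1, (φ z).2ᵀ) = z := by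
    refine Prod.ext e1 ?_
    rw [← hsymm, ← e2]
    simp only [riccatiMap, transpose_add, transpose_mul, transpose_transpose, hP.transpose_eq]
    noncomm_ring
  rw [e3] at h2
  have e4 : (φ z).2ᵀ = (φ z).2 := (congrArg Prod.snd h2).symm
  exact ⟨h3 e4, by rw [← e1]; exact e2⟩

/-- Positive semidefinite solutions are positive definite under observability. -/
theorem isInfoSolution_of_posSemidef {A Q P Y : Matrix ι ι ℝ} (hQ : Q.PosSemidef)
    (hobs : ∀ v, (∀ k : ℕ, Q *ᵥ ((A ^ k) *ᵥ v) = 0) → v = 0) (hY : Y.PosSemidef)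
    (h : Y * A + Aᵀ * Y + Y * P * Y = Q) : IsInfoSolution A Q P Y := by
  -- The kernel of `Y` is `A`-invariant and contained in that of `Q`, so it consists of unobservable
  -- vectors.
  have step : ∀ w, Y *ᵥ w = 0 → Q *ᵥ w = 0 ∧ Y *ᵥ (A *ᵥ w) = 0 := by
    intro w hw
    have e : Q *ᵥ w = Y *ᵥ (A *ᵥ w) := by
      rw [← h, add_mulVec, add_mulVec, ← mulVec_mulVec, ← mulVec_mulVec, ← mulVec_mulVec, hw]
      simp
    have hQw : Q *ᵥ w = 0 := hQ.mulVec_eq_zero (by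
      rw [e, dotProduct_mulVec, ← mulVec_transpose, hY.transpose_eq, hw, zero_dotProduct])
    exact ⟨hQw, by rw [← e, hQw]⟩
  refine ⟨posDef_iff_real.2 ⟨hY.transpose_eq, fun v hv => ?_⟩, h⟩
  refine lt_of_le_of_ne ((posSemidef_iff_real.1 hY).2 v) fun h0 => hv (hobs v fun k => ?_)
  have hk : ∀ k : ℕ, Y *ᵥ ((A ^ k) *ᵥ v) = 0 := by
    intro k
    induction k with
    | zero => simpa using hY.mulVec_eq_zero h0.symm
    | succ k ih => rw [pow_succ', ← mulVec_mulVec]; exact (step _ ih).2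
  exact (step _ (hk k)).1

/-- A priori bound for solutions, by completing the square. -/
theorem exists_isCompact_solutions (A P : Matrix ι ι ℝ) (hP : P.PosDef) (C : ℝ) :
    ∃ K : Set (Matrix ι ι ℝ), IsCompact K ∧ ∀ Q Y : Matrix ι ι ℝ, Yᵀ = Y → Q.trace ≤ C →
      Y * A + Aᵀ * Y + Y * P * Y = Q → Y ∈ K := by
  obtain ⟨B, hB, hPB⟩ := hP.exists_eq_transpose_mul_self
  have hBd := (isUnit_iff_isUnit_det _).1 hB
  have h1 : B⁻¹ * B = 1 := nonsing_inv_mul _ hBd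
  have hPd := (isUnit_iff_isUnit_det _).1 hP.isUnit
  have h2 : P * P⁻¹ = 1 := mul_nonsing_inv _ hPd
  -- With `P = Bᵀ B` and `W = B (Y + P⁻¹ A)` the equation reads `Wᵀ W = Q + Aᵀ P⁻¹ A`, so `r` bounds
  -- the squared Frobenius norm of `W`.
  set r := C + (Aᵀ * P⁻¹ * A).trace
  set box : Set (Matrix ι ι ℝ) := Set.pi univ fun _ => Set.pi univ fun _ => Icc (-√r) (√r)
  have hbox : IsCompact box :=
    isCompact_univ_pi fun _ => isCompact_univ_pi fun _ => isCompact_Icc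
  refine ⟨(fun W => B⁻¹ * W - P⁻¹ * A) '' box, hbox.image (by fun_prop), fun Q Y hY hQ hE => ?_⟩
  refine ⟨B * (Y + P⁻¹ * A), ?_, ?_⟩
  · set W := B * (Y + P⁻¹ * A) with hW
    have e : Wᵀ * W = Q + Aᵀ * P⁻¹ * A := by
      have h3 : P⁻¹ * P = 1 := nonsing_inv_mul _ hPd
      have : Wᵀ * W = (Y + Aᵀ * P⁻¹) * P * (Y + P⁻¹ * A) := by
        rw [hW, transpose_mul, transpose_add, transpose_mul, hY, hP.inv.transpose_eq, hPB]
        noncomm_ring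
      rw [this, ← hE]
      have e1 : (Y + Aᵀ * P⁻¹) * P = Y * P + Aᵀ := by
        rw [Matrix.add_mul, Matrix.mul_assoc, h3, Matrix.mul_one]
      have e2 : Y * P * (P⁻¹ * A) = Y * A := by
        rw [Matrix.mul_assoc, ← Matrix.mul_assoc P, h2, Matrix.one_mul]
      rw [e1, Matrix.add_mul, Matrix.mul_add, Matrix.mul_add, e2, ← Matrix.mul_assoc Aᵀ]
      abel
    have htr : ∑ i, ∑ j, W j i ^ 2 ≤ r := by
      have := congrArg trace e
      rw [trace_add] at this
      have e' : (Wᵀ * W).trace = ∑ i, ∑ j, W j i ^ 2 := by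
        simp only [trace, diag, mul_apply, transpose_apply, sq]
      rw [← e', this]
      exact add_le_add_left hQ _
    intro i _ j _
    have hij : W i j ^ 2 ≤ r := by
      refine le_trans ?_ htr
      refine le_trans ?_ (Finset.single_le_sum (f := fun j => ∑ i, W i j ^ 2)
        (fun _ _ => Finset.sum_nonneg fun _ _ => sq_nonneg _) (Finset.mem_univ j))
      exact Finset.single_le_sum (f := fun i => W i j ^ 2) (fun _ _ => sq_nonneg _)
        (Finset.mem_univ i)
    exact abs_le.1 (Real.abs_le_sqrt hij)
  · simp only
    rw [← Matrix.mul_assoc, h1, Matrix.one_mul, add_sub_cancel_right]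

/-- Existence of a positive definite solution, by continuation from an explicitly solvable
equation. -/
theorem exists_isInfoSolution {A Q P : Matrix ι ι ℝ} (hP : P.PosDef) (hQ : Q.PosSemidef)
    (hobs : ∀ v, (∀ k : ℕ, Q *ᵥ ((A ^ k) *ᵥ v) = 0) → v = 0) : ∃ Y, IsInfoSolution A Q P Y := by
  -- The matrix `κ • 1` solves the equation with this right-hand side, which is positive definite
  -- for large `κ`; here `κ = s⁻¹` with `s` small.
  obtain ⟨κ, hκ, hQ₀⟩ : ∃ κ : ℝ, 0 < κ ∧ (κ • (A + Aᵀ) + κ ^ 2 • P).PosDef := by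
    have hlim : Filter.Tendsto (fun s : ℝ => P + s • (A + Aᵀ)) (nhdsWithin 0 (Ioi 0)) (nhds P) := by
      have : Continuous fun s : ℝ => P + s • (A + Aᵀ) := by fun_prop
      have := this.tendsto 0
      simp only [zero_smul, add_zero] at this
      exact this.mono_left nhdsWithin_le_nhds
    obtain ⟨s, hs, hs0⟩ := ((hlim.eventually hP.eventually_posDef).and self_mem_nhdsWithin).exists
    have hs0 : 0 < s := hs0
    have hs2 : 0 < s⁻¹ ^ 2 := by positivity
    have := (hs (by simp [hP.transpose_eq, add_comm])).smul hs2
    refine ⟨s⁻¹, inv_pos.2 hs0, ?_⟩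
    convert this using 1
    rw [smul_add (s⁻¹ ^ 2), smul_smul, add_comm, pow_two, mul_assoc s⁻¹, inv_mul_cancel₀ hs0.ne',
      mul_one]
  set Q₀ := κ • (A + Aᵀ) + κ ^ 2 • P
  set q : ℝ → Matrix ι ι ℝ := fun t => (1 - t) • Q₀ + t • Q with hq
  have hqc : Continuous q := by simp only [hq]; fun_prop
  have hqpos : ∀ t ∈ Icc (0 : ℝ) 1, (q t).PosSemidef := fun t ht =>
    (hQ₀.posSemidef.smul (sub_nonneg.2 ht.2)).add (hQ.smul ht.1)
  have hqobs : ∀ t ∈ Icc (0 : ℝ) 1, ∀ v, (∀ k : ℕ, q t *ᵥ ((A ^ k) *ᵥ v) = 0) → v = 0 := by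
    intro t ht v hv
    rcases eq_or_lt_of_le ht.2 with rfl | hlt
    · exact hobs v fun k => by simpa [hq] using hv k
    · by_contra hne
      have hpd : (q t).PosDef :=
        (hQ₀.smul (α := ℝ) (sub_pos.2 hlt)).add_posSemidef (hQ.smul ht.1)
      have h0 := (posDef_iff_real.1 hpd).2 v hne
      have := hv 0
      rw [pow_zero, one_mulVec] at this
      rw [this, dotProduct_zero] at h0
      exact lt_irrefl _ h0
  set s : Set ℝ := {t | ∃ Y, IsInfoSolution A (q t) P Y}
  suffices h : Icc (0 : ℝ) 1 ⊆ s by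
    obtain ⟨Y, hY⟩ := h (right_mem_Icc.2 zero_le_one)
    exact ⟨Y, by simpa [hq] using hY⟩
  have hsymm : ∀ t, (q t)ᵀ = q t := fun t => by
    simp only [hq, transpose_add, transpose_smul, hQ.transpose_eq, hQ₀.transpose_eq]
  -- Closedness: solutions stay in a compact set, their limits are positive semidefinite, and
  -- observability makes these definite. Openness to the right: the local solution map.
  refine IsClosed.Icc_subset_of_forall_mem_nhdsWithin ?_ ?_ ?_
  · obtain ⟨C, hC⟩ := (isCompact_Icc (a := (0 : ℝ)) (b := 1)).bddAbove_image
      (f := fun t => (q t).trace) (by fun_prop)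
    obtain ⟨K, hK, hKmem⟩ := exists_isCompact_solutions A P hP C
    have hcpt : IsCompact ((Icc (0 : ℝ) 1 ×ˢ K) ∩
        {z : ℝ × Matrix ι ι ℝ | z.2.PosSemidef ∧ z.2 * A + Aᵀ * z.2 + z.2 * P * z.2 = q z.1}) := by
      refine (isCompact_Icc.prod hK).inter_right ?_
      exact (isClosed_posSemidef.preimage continuous_snd).inter
        (isClosed_eq (by fun_prop) (by fun_prop))
    convert (hcpt.image continuous_fst).isClosed using 1
    ext t
    constructor
    · rintro ⟨⟨Y, hY⟩, ht⟩
      exact ⟨(t, Y), ⟨⟨ht, hKmem _ Y hY.1.transpose_eq (hC (mem_image_of_mem _ ht)) hY.2⟩,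
        hY.1.posSemidef, hY.2⟩, rfl⟩
    · rintro ⟨⟨t, Y⟩, ⟨⟨ht, -⟩, hY, hE⟩, rfl⟩
      exact ⟨⟨Y, isInfoSolution_of_posSemidef (hqpos t ht) (hqobs t ht) hY hE⟩, ht⟩
  · refine ⟨κ • 1, PosDef.one.smul hκ, ?_⟩
    simp [hq, Q₀, smul_smul, pow_two]
  · rintro t ⟨⟨Y, hY⟩, ht⟩
    obtain ⟨ψ, -, -, hψ⟩ := hY.exists_contDiffAt hP (hqpos t (Ico_subset_Icc_self ht))
    have hlim : Filter.Tendsto (fun t => (A, q t)) (nhds t) (nhds (A, q t)) :=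
      (by fun_prop : Continuous fun t => (A, q t)).tendsto t
    filter_upwards [nhdsWithin_le_nhds (hlim.eventually hψ)] with u hu
    exact ⟨_, hu (hsymm u)⟩

end Riccati

/-! ### Convexity of the error of a single system -/

section Convexity

open scoped Matrix.Norms.Operator ContDiff

variable {ι : Type} [Fintype ι]

theorem smul_mulVec_eq_zero_iff_of_ne {Q : Matrix ι ι ℝ} {s : ℝ} (hs : s ≠ 0) (v : ι → ℝ) :
    (s • Q) *ᵥ v = 0 ↔ Q *ᵥ v = 0 := by
  rw [smul_mulVec, smul_eq_zero_iff_right hs]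

variable [DecidableEq ι]

theorem hasDerivAt_matrix_inv {Y : ℝ → Matrix ι ι ℝ} {Y' : Matrix ι ι ℝ} {s : ℝ}
    (hY : HasDerivAt Y Y' s) (hu : IsUnit (Y s)) :
    HasDerivAt (fun t => (Y t)⁻¹) (-((Y s)⁻¹ * Y' * (Y s)⁻¹)) s := by
  obtain ⟨u, hu⟩ := hu
  have h := (hu ▸ hasFDerivAt_ringInverse (𝕜 := ℝ) u :
    HasFDerivAt Ring.inverse _ (Y s)).comp_hasDerivAt s hY
  have e : (fun t => (Y t)⁻¹) = Ring.inverse ∘ Y :=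
    funext fun t => nonsing_inv_eq_ringInverse (Y t)
  rw [e]
  refine h.congr_deriv ?_
  simp [← hu]

theorem contDiffAt_matrix_inv {E : Type*} [NormedAddCommGroup E] [NormedSpace ℝ E]
    {Y : E → Matrix ι ι ℝ} {x : E} (hY : ContDiffAt ℝ ∞ Y x) (hu : IsUnit (Y x)) :
    ContDiffAt ℝ ∞ (fun t => (Y t)⁻¹) x := by
  obtain ⟨u, hu⟩ := hu
  have e : (fun t => (Y t)⁻¹) = Ring.inverse ∘ Y :=
    funext fun t => nonsing_inv_eq_ringInverse (Y t)
  rw [e]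
  exact (hu ▸ contDiffAt_ringInverse ℝ u : ContDiffAt ℝ ∞ Ring.inverse (Y x)).comp x hY

/-- The trace as a continuous linear map. -/
noncomputable def traceCLM (ι : Type) [Fintype ι] [DecidableEq ι] : Matrix ι ι ℝ →L[ℝ] ℝ :=
  LinearMap.toContinuousLinearMap (traceLinearMap ι ℝ ℝ)

theorem deriv_transpose_eq {Y : ℝ → Matrix ι ι ℝ} {Y' : Matrix ι ι ℝ} {s : ℝ}
    (hY : HasDerivAt Y Y' s) (hsymm : ∀ᶠ t in nhds s, (Y t)ᵀ = Y t) : Y'ᵀ = Y' := by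
  have h : HasDerivAt (fun t => (Y t)ᵀ) Y'ᵀ s := (transposeCLM ι).hasFDerivAt.comp_hasDerivAt s hY
  exact h.unique (hY.congr_of_eventuallyEq hsymm)

/-- Two differentiations of the equation give `Y'' K + Kᵀ Y'' = -2 Y' P Y'`, so `-Y''` is positive
semidefinite by `lyapunov_posSemidef`. With `X = Y⁻¹`, the second derivative of the trace is `2 tr
(Y' X Y' X²) + tr (X (-Y'') X)`. The first term is positive, because `Y' = 0` would force `Q = 0` in
the once differentiated equation. -/
theorem deriv_deriv_trace_inv_pos {A Q P : Matrix ι ι ℝ} (hP : P.PosDef) (hQ : Q.PosSemidef)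
    (hQ0 : Q ≠ 0) {Y : ℝ → Matrix ι ι ℝ} {s : ℝ} (hs : 0 < s) (hY : ContDiffAt ℝ ∞ Y s)
    (hsol : ∀ᶠ t in nhds s, IsInfoSolution A (t • Q) P (Y t)) :
    0 < deriv (deriv fun t => ((Y t)⁻¹).trace) s := by
  set Y₁ := deriv Y
  set Y₂ := deriv Y₁ s with hY₂
  have hd : ∀ᶠ t in nhds s, HasDerivAt Y (Y₁ t) t := by
    have h1 : ContDiffAt ℝ 1 Y s := hY.of_le (by exact_mod_cast le_top)
    filter_upwards [h1.eventually (by simp)] with t ht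
    exact (ht.differentiableAt one_ne_zero).hasDerivAt
  have hd₁ : HasDerivAt Y₁ Y₂ s := by
    have h1 : ContDiffAt ℝ 1 Y₁ s :=
      ((hY.fderiv_right (m := 1) (by norm_cast)).clm_apply
        (contDiffAt_const (c := (1 : ℝ))) :)
    exact (h1.differentiableAt one_ne_zero).hasDerivAt
  have hE₁ : ∀ᶠ t in nhds s, Y₁ t * A + Aᵀ * Y₁ t + (Y₁ t * P * Y t + Y t * P * Y₁ t) = Q := by
    filter_upwards [hd, hsol.eventually_nhds] with t ht hst
    have h1 := ((ht.mul_const A).add (ht.const_mul Aᵀ)).add ((ht.mul_const P).mul ht)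
    have h2 : HasDerivAt (fun t : ℝ => t • Q) ((1 : ℝ) • Q) t := (hasDerivAt_id t).smul_const Q
    rw [one_smul] at h2
    exact (h1.congr_of_eventuallyEq (hst.mono fun u hu => hu.2.symm)).unique h2
  have hds := hd.self_of_nhds
  have hss := hsol.self_of_nhds
  have hE₂ : Y₂ * A + Aᵀ * Y₂ + ((Y₂ * P * Y s + Y₁ s * P * Y₁ s) +
      (Y₁ s * P * Y₁ s + Y s * P * Y₂)) = 0 := by
    have h1 := ((hd₁.mul_const A).add (hd₁.const_mul Aᵀ)).add
      (((hd₁.mul_const P).mul hds).add ((hds.mul_const P).mul hd₁))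
    exact (h1.congr_of_eventuallyEq (hE₁.mono fun u hu => hu.symm)).unique (hasDerivAt_const s Q)
  have hsymm : ∀ᶠ t in nhds s, (Y t)ᵀ = Y t := hsol.mono fun t ht => ht.1.transpose_eq
  have hsymm₁ : ∀ᶠ t in nhds s, (Y₁ t)ᵀ = Y₁ t := by
    filter_upwards [hd, hsymm.eventually_nhds] with t ht h
    exact deriv_transpose_eq ht h
  have hsymm₂ : Y₂ᵀ = Y₂ := deriv_transpose_eq hd₁ hsymm₁
  have hs₁ : (Y₁ s)ᵀ = Y₁ s := hsymm₁.self_of_nhds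
  have hneg : (-Y₂).PosSemidef := by
    refine lyapunov_posSemidef hss.1 (hss.lyapunov_posDef hP (hQ.smul hs.le))
      (by rw [transpose_neg, hsymm₂]) ?_
    have e : -Y₂ * (A + P * Y s) + (A + P * Y s)ᵀ * -Y₂
        = (Y₁ s)ᵀ * P * Y₁ s + (Y₁ s)ᵀ * P * Y₁ s := by
      rw [← sub_eq_zero, ← neg_eq_zero, ← hE₂, hs₁, transpose_add, transpose_mul, hP.transpose_eq,
        hss.1.transpose_eq]
      noncomm_ring
    rw [e]
    have := hP.posSemidef.conjTranspose_mul_mul_same (Y₁ s)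
    exact this.add this
  have hinv : ∀ᶠ t in nhds s, HasDerivAt (fun t => (Y t)⁻¹) (-((Y t)⁻¹ * Y₁ t * (Y t)⁻¹)) t := by
    filter_upwards [hd, hsol] with t ht h
    exact hasDerivAt_matrix_inv ht h.1.isUnit
  have hη₁ : deriv (fun t => ((Y t)⁻¹).trace) =ᶠ[nhds s]
      fun t => -((Y t)⁻¹ * Y₁ t * (Y t)⁻¹).trace := by
    filter_upwards [hinv] with t ht
    rw [← trace_neg]
    exact ((traceCLM ι).hasFDerivAt.comp_hasDerivAt t ht).deriv
  set X := (Y s)⁻¹ with hX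
  have hXd : X.PosDef := hss.1.inv
  have hη₂ : deriv (fun t => -((Y t)⁻¹ * Y₁ t * (Y t)⁻¹).trace) s
      = -((-(X * Y₁ s * X) * Y₁ s + X * Y₂) * X + X * Y₁ s * -(X * Y₁ s * X)).trace := by
    have h := (hinv.self_of_nhds.mul hd₁).mul hinv.self_of_nhds
    exact ((traceCLM ι).hasFDerivAt.comp_hasDerivAt s h).neg.deriv
  rw [hη₁.deriv_eq, hη₂]
  have e1 : -((-(X * Y₁ s * X) * Y₁ s + X * Y₂) * X + X * Y₁ s * -(X * Y₁ s * X)).trace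
      = 2 * ((Y₁ s)ᵀ * X * Y₁ s * (X * X)).trace + (Xᵀ * -Y₂ * X).trace := by
    have e2 : ((Y₁ s)ᵀ * X * Y₁ s * (X * X)).trace = (X * Y₁ s * X * Y₁ s * X).trace := by
      rw [← Matrix.mul_assoc, trace_mul_comm, hs₁]
      simp only [Matrix.mul_assoc]
    rw [e2, hXd.transpose_eq, two_mul, ← trace_neg, ← trace_add, ← trace_add]
    congr 1
    noncomm_ring
  have hXX : (X * X).PosDef := by
    have := PosDef.conjTranspose_mul_self X (mulVec_injective_iff_isUnit.2 hXd.isUnit)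
    rwa [conjTranspose_eq_transpose_of_trivial, hXd.transpose_eq] at this
  have h1 : 0 ≤ (Xᵀ * -Y₂ * X).trace := (hneg.conjTranspose_mul_mul_same X).trace_nonneg
  have h2 : 0 ≤ ((Y₁ s)ᵀ * X * Y₁ s * (X * X)).trace :=
    trace_transpose_mul_mul_mul_nonneg hXd.posSemidef hXX.posSemidef _
  have h3 : ((Y₁ s)ᵀ * X * Y₁ s * (X * X)).trace ≠ 0 := by
    intro h
    have h0 := eq_zero_of_trace_transpose_mul_mul_mul_eq_zero hXd hXX h
    have := hE₁.self_of_nhds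
    rw [h0] at this
    exact hQ0 (by rw [← this]; simp)
  have := lt_of_le_of_ne h2 h3.symm
  rw [e1]
  linarith

/-- The error `tr Σ` of a single system as a function of the intensity of observation. -/
noncomputable def traceError (A Q P : Matrix ι ι ℝ) (s : ℝ) : ℝ :=
  ((Classical.epsilon (IsInfoSolution A (s • Q) P))⁻¹).trace

/-- By uniqueness, the chosen solution coincides near `s` with the smooth local branch. -/
theorem traceError_regular {A Q P : Matrix ι ι ℝ} (hP : P.PosDef) (hQ : Q.PosSemidef)
    (hQ0 : Q ≠ 0) (hobs : ∀ v, (∀ k : ℕ, Q *ᵥ ((A ^ k) *ᵥ v) = 0) → v = 0) {s : ℝ} (hs : 0 < s) :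
    ContDiffAt ℝ ∞ (traceError A Q P) s ∧ 0 < deriv (deriv (traceError A Q P)) s := by
  obtain ⟨Y, hY⟩ := exists_isInfoSolution hP (hQ.smul hs.le)
    fun v hv => hobs v fun k => (smul_mulVec_eq_zero_iff_of_ne hs.ne' _).1 (hv k)
  obtain ⟨ψ, hψ0, hψ, hev⟩ := hY.exists_contDiffAt hP (hQ.smul hs.le)
  have hc : ContDiff ℝ ∞ fun t : ℝ => (A, t • Q) := by fun_prop
  have hcomp : ContDiffAt ℝ ∞ (fun t : ℝ => ψ (A, t • Q)) s :=
    ContDiffAt.comp (f := fun t : ℝ => (A, t • Q)) s hψ hc.contDiffAt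
  have hsol : ∀ᶠ t in nhds s, IsInfoSolution A (t • Q) P (ψ (A, t • Q)) := by
    filter_upwards [(hc.continuous.tendsto s).eventually hev] with t ht
    exact ht (by simp [hQ.transpose_eq])
  have heq : traceError A Q P =ᶠ[nhds s] fun t => ((ψ (A, t • Q))⁻¹).trace := by
    filter_upwards [hsol, lt_mem_nhds hs] with t ht h0
    rw [traceError, (Classical.epsilon_spec ⟨_, ht⟩ : IsInfoSolution A (t • Q) P _).unique hP
      (hQ.smul h0.le) ht]
  constructor
  · refine ContDiffAt.congr_of_eventuallyEq ?_ heq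
    exact (traceCLM ι).contDiff.contDiffAt.comp s
      (contDiffAt_matrix_inv hcomp hsol.self_of_nhds.1.isUnit)
  · rw [heq.deriv.deriv_eq]
    exact deriv_deriv_trace_inv_pos hP hQ hQ0 hs hcomp hsol

end Convexity

/-! ### The network -/

section ObservableSystems

variable {n p N : ℕ}

theorem eq_zero_of_transpose_mul_self_mulVec {c : Matrix (Fin n) (Fin p) ℝ} {w : Fin n → ℝ}
    (h : (c * cᵀ) *ᵥ w = 0) : cᵀ *ᵥ w = 0 := by
  have h1 : (cᵀ *ᵥ w) ⬝ᵥ (cᵀ *ᵥ w) = 0 := by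
    rw [dotProduct_mulVec, vecMul_transpose, mulVec_mulVec, h, zero_dotProduct]
  exact dotProduct_self_eq_zero.1 h1

/-- Full column rank is a trivial kernel, and `c * cᵀ` has the kernel of `cᵀ`. This is the form of
observability that the existence theorem uses. -/
theorem IsObservable.eq_zero {A : Matrix (Fin n) (Fin n) ℝ} {c : Matrix (Fin n) (Fin p) ℝ}
    (h : IsObservable A c) {v : Fin n → ℝ} (hv : ∀ k : ℕ, (c * cᵀ) *ᵥ ((A ^ k) *ᵥ v) = 0) :
    v = 0 := by
  have hinj : Function.Injective (observabilityMatrix A c).mulVec := by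
    rw [mulVec_injective_iff, linearIndependent_iff_card_eq_finrank_span, Fintype.card_fin]
    exact h.symm.trans (rank_eq_finrank_span_cols _)
  refine hinj ?_
  rw [mulVec_zero]
  ext kj
  have := congrFun (eq_zero_of_transpose_mul_self_mulVec (hv kj.1)) kj.2
  rw [mulVec_mulVec] at this
  exact this

theorem IsObservable.mul_transpose_ne_zero {A : Matrix (Fin n) (Fin n) ℝ}
    {c : Matrix (Fin n) (Fin p) ℝ} (h : IsObservable A c) (hn : 0 < n) : c * cᵀ ≠ 0 := by
  intro h0
  have := congrFun (h.eq_zero (v := fun _ => 1) (fun k => by rw [h0, zero_mulVec])) ⟨0, hn⟩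
  exact one_ne_zero this

theorem posSemidef_mul_transpose (c : Matrix (Fin n) (Fin p) ℝ) : (c * cᵀ).PosSemidef := by
  simpa [conjTranspose_eq_transpose_of_trivial] using posSemidef_self_mul_conjTranspose c

end ObservableSystems

/-! ### Block-diagonal matrices and decoupled Riccati equations -/

section BlockDiagonal

variable {n N : ℕ}

theorem blockDiagonal_mulVec_apply (M : Fin N → Matrix (Fin n) (Fin n) ℝ) (v : Fin n × Fin N → ℝ)
    (a : Fin n) (i : Fin N) :
    (blockDiagonal M *ᵥ v) (a, i) = (M i *ᵥ fun b => v (b, i)) a := by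
  simp [mulVec, dotProduct, Fintype.sum_prod_type, blockDiagonal_apply]

theorem dotProduct_blockDiagonal_mulVec (M : Fin N → Matrix (Fin n) (Fin n) ℝ)
    (v : Fin n × Fin N → ℝ) :
    v ⬝ᵥ blockDiagonal M *ᵥ v = ∑ i, (fun b => v (b, i)) ⬝ᵥ M i *ᵥ fun b => v (b, i) := by
  simp only [dotProduct, Fintype.sum_prod_type, blockDiagonal_mulVec_apply]
  rw [Finset.sum_comm]

theorem posSemidef_blockDiagonal {M : Fin N → Matrix (Fin n) (Fin n) ℝ}
    (h : ∀ i, (M i).PosSemidef) : (blockDiagonal M).PosSemidef := by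
  refine posSemidef_iff_real.2 ⟨?_, fun v => ?_⟩
  · rw [blockDiagonal_transpose]; congr 1; ext1 i; exact (h i).transpose_eq
  · rw [dotProduct_blockDiagonal_mulVec]
    exact Finset.sum_nonneg fun i _ => (posSemidef_iff_real.1 (h i)).2 _

theorem posDef_blockDiagonal {M : Fin N → Matrix (Fin n) (Fin n) ℝ}
    (h : ∀ i, (M i).PosDef) : (blockDiagonal M).PosDef := by
  refine posDef_iff_real.2 ⟨?_, fun v hv => ?_⟩
  · rw [blockDiagonal_transpose]; congr 1; ext1 i; exact (h i).transpose_eq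
  · rw [dotProduct_blockDiagonal_mulVec]
    obtain ⟨⟨a, i⟩, hai⟩ := Function.ne_iff.1 hv
    refine Finset.sum_pos' (fun i _ => (posSemidef_iff_real.1 (h i).posSemidef).2 _)
      ⟨i, Finset.mem_univ i, (posDef_iff_real.1 (h i)).2 _ fun h0 => hai (congrFun h0 a)⟩

theorem blockDiagonal_inv_of_posDef {M : Fin N → Matrix (Fin n) (Fin n) ℝ}
    (h : ∀ i, (M i).PosDef) : (blockDiagonal M)⁻¹ = blockDiagonal fun i => (M i)⁻¹ := by
  refine inv_eq_right_inv ?_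
  rw [← blockDiagonal_mul, ← blockDiagonal_one]
  congr 1
  ext1 i
  exact mul_nonsing_inv _ ((isUnit_iff_isUnit_det _).1 (h i).isUnit)

theorem isInfoSolution_blockDiagonal {A Q P Y : Fin N → Matrix (Fin n) (Fin n) ℝ}
    (h : ∀ i, IsInfoSolution (A i) (Q i) (P i) (Y i)) :
    IsInfoSolution (blockDiagonal A) (blockDiagonal Q) (blockDiagonal P) (blockDiagonal Y) := by
  refine ⟨posDef_blockDiagonal fun i => (h i).1, ?_⟩
  rw [blockDiagonal_transpose]
  simp only [← blockDiagonal_mul, ← blockDiagonal_add]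
  congr 1
  ext1 i
  exact (h i).2

end BlockDiagonal

/-! ### The network Riccati equation and smoothness of the error -/

namespace Network

open scoped Matrix.Norms.Operator ContDiff

variable {N n p : ℕ}

/-- The information rate `c_γ c_γᵀ`. -/
def infoRate (S : Network N n p) (rmin : ℝ) (γ : Fin N → ℝ) :
    Matrix (Fin n × Fin N) (Fin n × Fin N) ℝ :=
  blockDiagonal fun i => (γ i + rmin) • (S.c i * (S.c i)ᵀ)

/-- Kernel form of the observability of the network with all the sensors in use. -/
def IsNetObservable (S : Network N n p) (ε : ℝ) : Prop :=
  ∀ v : Fin n × Fin N → ℝ,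
    (∀ k : ℕ, (blockDiagonal fun i => S.c i * (S.c i)ᵀ) *ᵥ ((S.drift ε ^ k) *ᵥ v) = 0) → v = 0

variable {S : Network N n p} {rmin ε : ℝ} {γ : Fin N → ℝ}

theorem obs_mul_transpose (hγ : ∀ i, 0 ≤ γ i + rmin) :
    S.obs rmin γ * (S.obs rmin γ)ᵀ = S.infoRate rmin γ := by
  rw [obs, infoRate, blockDiagonal_transpose, ← blockDiagonal_mul]
  congr 1
  ext1 i
  rw [transpose_smul, Matrix.smul_mul, Matrix.mul_smul, smul_smul, Real.mul_self_sqrt (hγ i)]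

theorem posSemidef_infoRate (hγ : ∀ i, 0 ≤ γ i + rmin) : (S.infoRate rmin γ).PosSemidef :=
  posSemidef_blockDiagonal fun i => (posSemidef_mul_transpose _).smul (hγ i)

theorem IsAdmissible.posDef_mul_transpose (hS : S.IsAdmissible) (i : Fin N) :
    (S.G i * (S.G i)ᵀ).PosDef :=
  (hS i).2.2.2.1

theorem noise_mul_transpose :
    S.noise * S.noiseᵀ = blockDiagonal fun i => S.G i * (S.G i)ᵀ := by
  rw [noise, blockDiagonal_transpose, ← blockDiagonal_mul]

theorem IsAdmissible.posDef_noise (hS : S.IsAdmissible) : (S.noise * S.noiseᵀ).PosDef := by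
  rw [noise_mul_transpose]
  exact posDef_blockDiagonal hS.posDef_mul_transpose

theorem isCovariance_iff (hγ : ∀ i, 0 ≤ γ i + rmin)
    {X : Matrix (Fin n × Fin N) (Fin n × Fin N) ℝ} :
    S.IsCovariance ε rmin γ X ↔ X.PosDef ∧
      IsInfoSolution (S.drift ε) (S.infoRate rmin γ) (S.noise * S.noiseᵀ) X⁻¹ := by
  rw [IsCovariance, isPosDefRiccatiSolution_iff, obs_mul_transpose hγ]

theorem isCovariance_inv (hγ : ∀ i, 0 ≤ γ i + rmin)
    {Y : Matrix (Fin n × Fin N) (Fin n × Fin N) ℝ}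
    (hY : IsInfoSolution (S.drift ε) (S.infoRate rmin γ) (S.noise * S.noiseᵀ) Y) :
    S.IsCovariance ε rmin γ Y⁻¹ := by
  rw [isCovariance_iff hγ]
  refine ⟨hY.1.inv, ?_⟩
  rwa [nonsing_inv_nonsing_inv _ ((isUnit_iff_isUnit_det _).1 hY.1.isUnit)]

theorem IsAdmissible.isCovariance_unique (hS : S.IsAdmissible) (hγ : ∀ i, 0 ≤ γ i + rmin)
    {X X' : Matrix (Fin n × Fin N) (Fin n × Fin N) ℝ} (h : S.IsCovariance ε rmin γ X)
    (h' : S.IsCovariance ε rmin γ X') : X = X' := by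
  rw [isCovariance_iff hγ] at h h'
  exact inv_inj (h.2.unique hS.posDef_noise (posSemidef_infoRate hγ) h'.2)
    ((isUnit_iff_isUnit_det _).1 h.1.isUnit)

theorem IsAdmissible.error_eq (hS : S.IsAdmissible) (hγ : ∀ i, 0 ≤ γ i + rmin)
    {Y : Matrix (Fin n × Fin N) (Fin n × Fin N) ℝ}
    (hY : IsInfoSolution (S.drift ε) (S.infoRate rmin γ) (S.noise * S.noiseᵀ) Y) :
    S.error ε rmin γ = Y⁻¹.trace := by
  have h := isCovariance_inv hγ hY
  rw [error, covariance, hS.isCovariance_unique hγ (Classical.epsilon_spec ⟨_, h⟩) h]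

/-- All weights `γ i + rmin` are positive, so they do not change the kernel of the information rate,
and observability is independent of `γ`. -/
theorem IsNetObservable.exists_isInfoSolution (hobs : S.IsNetObservable ε) (hS : S.IsAdmissible)
    (hγ : ∀ i, 0 < γ i + rmin) :
    ∃ Y, IsInfoSolution (S.drift ε) (S.infoRate rmin γ) (S.noise * S.noiseᵀ) Y := by
  refine _root_.exists_isInfoSolution hS.posDef_noise (posSemidef_infoRate fun i => (hγ i).le)
    fun v hv => hobs v fun k => ?_
  ext ⟨a, i⟩
  have := congrFun (hv k) (a, i)
  rw [infoRate, blockDiagonal_mulVec_apply, smul_mulVec, Pi.smul_apply, Pi.zero_apply,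
    smul_eq_zero_iff_right (hγ i).ne'] at this
  rw [blockDiagonal_mulVec_apply, this, Pi.zero_apply]

theorem IsNetObservable.existsUnique_isCovariance (hobs : S.IsNetObservable ε)
    (hS : S.IsAdmissible) (hγ : ∀ i, 0 < γ i + rmin) : ∃! X, S.IsCovariance ε rmin γ X := by
  obtain ⟨Y, hY⟩ := hobs.exists_isInfoSolution hS hγ
  have h := isCovariance_inv (fun i => (hγ i).le) hY
  exact ⟨_, h, fun X hX => hS.isCovariance_unique (fun i => (hγ i).le) hX h⟩

theorem contDiff_drift : ContDiff ℝ ∞ S.drift := by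
  have : S.drift = fun ε => S.drift 0 + ε • (S.drift 1 - S.drift 0) := by
    ext ε a b
    simp only [drift, of_apply, Matrix.add_apply, Matrix.smul_apply, Matrix.sub_apply, smul_eq_mul]
    split_ifs <;> ring
  rw [this]
  fun_prop

theorem contDiff_infoRate : ContDiff ℝ ∞ (S.infoRate rmin) := by
  have : S.infoRate rmin = fun γ => ∑ i, (γ i + rmin) •
      blockDiagonal (Pi.single i (S.c i * (S.c i)ᵀ)) := by
    ext γ ⟨a, i⟩ ⟨b, j⟩
    rw [Matrix.sum_apply]
    simp only [infoRate, blockDiagonal_apply, Matrix.smul_apply]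
    split_ifs with h
    · rw [Finset.sum_eq_single i]
      · simp
      · intro k _ hk; simp [Pi.single_eq_of_ne hk.symm]
      · simp
    · simp
  rw [this]
  fun_prop

/-- The error is a smooth function of the coupling strength and of the allocation. -/
theorem IsNetObservable.contDiffAt_error (hobs : S.IsNetObservable ε) (hS : S.IsAdmissible)
    (hγ : ∀ i, 0 < γ i + rmin) :
    ContDiffAt ℝ ∞ (fun z : ℝ × (Fin N → ℝ) => S.error z.1 rmin z.2) (ε, γ) := by
  obtain ⟨Y, hY⟩ := hobs.exists_isInfoSolution hS hγ
  obtain ⟨ψ, hψ0, hψ, hev⟩ :=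
    hY.exists_contDiffAt hS.posDef_noise (posSemidef_infoRate fun i => (hγ i).le)
  have hc : ContDiff ℝ ∞ fun z : ℝ × (Fin N → ℝ) => (S.drift z.1, S.infoRate rmin z.2) :=
    (contDiff_drift.comp contDiff_fst).prodMk (contDiff_infoRate.comp contDiff_snd)
  have hcomp : ContDiffAt ℝ ∞
      (fun z : ℝ × (Fin N → ℝ) => ψ (S.drift z.1, S.infoRate rmin z.2)) (ε, γ) :=
    ContDiffAt.comp (f := fun z : ℝ × (Fin N → ℝ) => (S.drift z.1, S.infoRate rmin z.2)) (ε, γ)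
      hψ hc.contDiffAt
  have hnear : ∀ᶠ z : ℝ × (Fin N → ℝ) in nhds (ε, γ), ∀ i, 0 < z.2 i + rmin := by
    refine Filter.eventually_all.2 fun i => ?_
    have : Continuous fun z : ℝ × (Fin N → ℝ) => z.2 i + rmin := by fun_prop
    exact (this.tendsto (ε, γ)).eventually (lt_mem_nhds (hγ i))
  have heq : (fun z : ℝ × (Fin N → ℝ) => S.error z.1 rmin z.2) =ᶠ[nhds (ε, γ)]
      fun z => ((ψ (S.drift z.1, S.infoRate rmin z.2))⁻¹).trace := by
    filter_upwards [(hc.continuous.tendsto (ε, γ)).eventually hev, hnear] with z hz hp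
    have hp' := fun i => (hp i).le
    exact hS.error_eq hp' (hz (posSemidef_infoRate hp').transpose_eq)
  refine ContDiffAt.congr_of_eventuallyEq ?_ heq
  refine (traceCLM _).contDiff.contDiffAt.comp (ε, γ) (contDiffAt_matrix_inv hcomp ?_)
  simpa only [hψ0] using hY.1.isUnit

theorem drift_zero : S.drift 0 = blockDiagonal S.A := by
  ext ⟨a, i⟩ ⟨b, j⟩
  simp [drift, blockDiagonal_apply]

/-- At `ε = 0` observability holds block by block. Near each unit vector some fixed output stays
nonzero for small `ε`, and compactness of the sphere makes the range of `ε` uniform. -/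
theorem IsAdmissible.eventually_isNetObservable (hS : S.IsAdmissible) :
    ∀ᶠ ε in nhds (0 : ℝ), S.IsNetObservable ε := by
  set Q : Matrix (Fin n × Fin N) (Fin n × Fin N) ℝ := blockDiagonal fun i => S.c i * (S.c i)ᵀ
  have key : ∀ v : Fin n × Fin N → ℝ, v ≠ 0 → ∃ k : ℕ, Q *ᵥ ((S.drift 0 ^ k) *ᵥ v) ≠ 0 := by
    intro v hv
    by_contra! h
    refine hv (funext fun ⟨a, i⟩ => ?_)
    refine congrFun ((hS i).1.eq_zero (v := fun b => v (b, i)) fun k => ?_) a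
    ext b
    have := congrFun (h k) (b, i)
    rw [blockDiagonal_mulVec_apply, drift_zero, ← blockDiagonal_pow] at this
    simp only [blockDiagonal_mulVec_apply] at this
    exact this
  have hev := (isCompact_sphere (0 : Fin n × Fin N → ℝ) 1).eventually_forall_of_forall_eventually
    (x₀ := (0 : ℝ)) (P := fun ε v => ∃ k : ℕ, Q *ᵥ ((S.drift ε ^ k) *ᵥ v) ≠ 0) (fun v hv => by
      obtain ⟨k, hk⟩ := key v (by rintro rfl; simp at hv)
      have hd : Continuous S.drift := contDiff_drift.continuous
      have hc : Continuous fun z : ℝ × (Fin n × Fin N → ℝ) => Q *ᵥ ((S.drift z.1 ^ k) *ᵥ z.2) := by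
        fun_prop
      filter_upwards [(hc.tendsto (0, v)).eventually_ne hk] with z hz
      exact ⟨k, hz⟩)
  filter_upwards [hev] with ε hε v hv
  by_contra hne
  obtain ⟨k, hk⟩ := hε _ (exists_smul_mem_sphere hne)
  rw [mulVec_smul, mulVec_smul, hv k, smul_zero] at hk
  exact hk rfl

/-- Without coupling the error is a sum of the errors of the subsystems. -/
theorem IsAdmissible.error_zero_eq_sum (hS : S.IsAdmissible) (hγ : ∀ i, 0 < γ i + rmin) :
    S.error 0 rmin γ = ∑ i, traceError (S.A i) (S.c i * (S.c i)ᵀ) (S.G i * (S.G i)ᵀ)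
      (γ i + rmin) := by
  have h : ∀ i, ∃ Y, IsInfoSolution (S.A i) ((γ i + rmin) • (S.c i * (S.c i)ᵀ))
      (S.G i * (S.G i)ᵀ) Y := fun i =>
    _root_.exists_isInfoSolution (hS.posDef_mul_transpose i)
      ((posSemidef_mul_transpose _).smul (hγ i).le)
      fun v hv => (hS i).1.eq_zero fun k =>
        (smul_mulVec_eq_zero_iff_of_ne (hγ i).ne' _).1 (hv k)
  have hY := fun i => Classical.epsilon_spec (h i)
  have hD := isInfoSolution_blockDiagonal hY
  rw [← drift_zero, ← noise_mul_transpose] at hD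
  rw [hS.error_eq (fun i => (hγ i).le) hD, blockDiagonal_inv_of_posDef fun i => (hY i).1,
    trace_blockDiagonal]
  rfl

end Network

/-! ### Second derivatives of the error -/

namespace Network

open scoped ContDiff

variable {N n p : ℕ} {S : Network N n p} {rmin ε : ℝ} {γ : Fin N → ℝ}

theorem errorPartial_eq_fderiv {z : ℝ × (Fin N → ℝ)} (i : Fin N)
    (h : DifferentiableAt ℝ (fun z : ℝ × (Fin N → ℝ) => S.error z.1 rmin z.2) z) :
    S.errorPartial z.1 rmin z.2 i =
      fderiv ℝ (fun z : ℝ × (Fin N → ℝ) => S.error z.1 rmin z.2) z (0, Pi.single i 1) := by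
  have h1 : HasDerivAt (fun t : ℝ => (z.1, Function.update z.2 i t))
      ((0 : ℝ), Pi.single i (1 : ℝ)) (z.2 i) :=
    (hasDerivAt_const (z.2 i) z.1).prodMk (hasDerivAt_update z.2 i (z.2 i))
  have h2 : HasFDerivAt (fun z : ℝ × (Fin N → ℝ) => S.error z.1 rmin z.2)
      (fderiv ℝ (fun z : ℝ × (Fin N → ℝ) => S.error z.1 rmin z.2) z)
      (z.1, Function.update z.2 i (z.2 i)) := by
    rw [Function.update_eq_self]; exact h.hasFDerivAt
  exact (h2.comp_hasDerivAt (z.2 i) h1).deriv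

theorem contDiffAt_errorPartial (i : Fin N)
    (h : ContDiffAt ℝ ∞ (fun z : ℝ × (Fin N → ℝ) => S.error z.1 rmin z.2) (ε, γ)) :
    ContDiffAt ℝ ∞ (fun z : ℝ × (Fin N → ℝ) => S.errorPartial z.1 rmin z.2 i) (ε, γ) := by
  have h1 : ContDiffAt ℝ 1 (fun z : ℝ × (Fin N → ℝ) => S.error z.1 rmin z.2) (ε, γ) :=
    h.of_le (by exact_mod_cast le_top)
  have heq : (fun z : ℝ × (Fin N → ℝ) => S.errorPartial z.1 rmin z.2 i) =ᶠ[nhds (ε, γ)]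
      fun z => fderiv ℝ (fun z : ℝ × (Fin N → ℝ) => S.error z.1 rmin z.2) z
        (0, Pi.single i 1) := by
    filter_upwards [h1.eventually (by simp)] with z hz
    exact errorPartial_eq_fderiv i (hz.differentiableAt one_ne_zero)
  exact ContDiffAt.congr_of_eventuallyEq
    ((h.fderiv_right (m := ∞) (by norm_cast)).clm_apply contDiffAt_const) heq

/-- The second partial derivatives of the error with respect to the allocation. -/
noncomputable def errorHess (S : Network N n p) (rmin : ℝ) (i j : Fin N)
    (z : ℝ × (Fin N → ℝ)) : ℝ :=
  fderiv ℝ (fun z : ℝ × (Fin N → ℝ) => S.errorPartial z.1 rmin z.2 i) z (0, Pi.single j 1)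

theorem continuousAt_errorHess (i j : Fin N)
    (h : ContDiffAt ℝ ∞ (fun z : ℝ × (Fin N → ℝ) => S.error z.1 rmin z.2) (ε, γ)) :
    ContinuousAt (S.errorHess rmin i j) (ε, γ) := by
  unfold errorHess
  exact (((contDiffAt_errorPartial i h).fderiv_right (m := ∞) (by norm_cast)).clm_apply
    (contDiffAt_const (c := ((0 : ℝ), Pi.single j (1 : ℝ))))).continuousAt

theorem fderiv_errorPartial_single (i j : Fin N)
    (h : ContDiffAt ℝ ∞ (fun z : ℝ × (Fin N → ℝ) => S.error z.1 rmin z.2) (ε, γ)) :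
    fderiv ℝ (fun γ => S.errorPartial ε rmin γ i) γ (Pi.single j 1)
      = S.errorHess rmin i j (ε, γ) := by
  have h1 := ((contDiffAt_errorPartial i h).differentiableAt (by simp)).hasFDerivAt
  have h2 := HasFDerivAt.comp (f := fun γ : Fin N → ℝ => (ε, γ)) γ h1 (hasFDerivAt_prodMk_right ε γ)
  rw [HasFDerivAt.fderiv (f := fun γ => S.errorPartial ε rmin γ i) h2]
  rfl

theorem fderiv_error_single (i : Fin N)
    (h : ContDiffAt ℝ ∞ (fun z : ℝ × (Fin N → ℝ) => S.error z.1 rmin z.2) (ε, γ)) :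
    fderiv ℝ (S.error ε rmin) γ (Pi.single i 1) = S.errorPartial ε rmin γ i := by
  have h1 := (h.differentiableAt (by simp))
  have h2 := HasFDerivAt.comp (f := fun γ : Fin N → ℝ => (ε, γ)) γ h1.hasFDerivAt
    (hasFDerivAt_prodMk_right ε γ)
  rw [HasFDerivAt.fderiv (f := S.error ε rmin) h2, errorPartial_eq_fderiv (z := (ε, γ)) i h1]
  rfl

theorem eventually_update_add_pos (hγ : ∀ i, 0 < γ i + rmin) (i : Fin N) :
    ∀ᶠ t in nhds (γ i), ∀ j, 0 < Function.update γ i t j + rmin := by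
  refine Filter.eventually_all.2 fun j => ?_
  have hc : Continuous fun t => Function.update γ i t j + rmin :=
    ((continuous_apply j).comp ((continuous_const (y := γ)).update i continuous_id)).add
      (continuous_const (y := rmin))
  refine (hc.tendsto (γ i)).eventually (lt_mem_nhds ?_)
  rw [Function.update_eq_self]
  exact hγ j

theorem IsAdmissible.traceError_regular (hS : S.IsAdmissible) (hn : 0 < n) (i : Fin N) {s : ℝ}
    (hs : 0 < s) :
    ContDiffAt ℝ ∞ (traceError (S.A i) (S.c i * (S.c i)ᵀ) (S.G i * (S.G i)ᵀ)) s ∧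
      0 < deriv (deriv (traceError (S.A i) (S.c i * (S.c i)ᵀ) (S.G i * (S.G i)ᵀ))) s :=
  _root_.traceError_regular (hS.posDef_mul_transpose i) (posSemidef_mul_transpose _)
    ((hS i).1.mul_transpose_ne_zero hn) (fun _ hv => (hS i).1.eq_zero hv) hs

theorem IsAdmissible.errorPartial_zero (hS : S.IsAdmissible) (hγ : ∀ i, 0 < γ i + rmin) (i : Fin N) :
    S.errorPartial 0 rmin γ i =
      deriv (traceError (S.A i) (S.c i * (S.c i)ᵀ) (S.G i * (S.G i)ᵀ)) (γ i + rmin) := by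
  have heq : (fun t => S.error 0 rmin (Function.update γ i t)) =ᶠ[nhds (γ i)]
      fun t => ∑ j, traceError (S.A j) (S.c j * (S.c j)ᵀ) (S.G j * (S.G j)ᵀ)
        (Function.update γ i t j + rmin) := by
    filter_upwards [eventually_update_add_pos hγ i] with t ht
    exact hS.error_zero_eq_sum ht
  have hsum : (fun t => ∑ j, traceError (S.A j) (S.c j * (S.c j)ᵀ) (S.G j * (S.G j)ᵀ)
      (Function.update γ i t j + rmin)) =
      fun t => traceError (S.A i) (S.c i * (S.c i)ᵀ) (S.G i * (S.G i)ᵀ) (t + rmin) +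
        ∑ j ∈ Finset.univ.erase i, traceError (S.A j) (S.c j * (S.c j)ᵀ) (S.G j * (S.G j)ᵀ)
          (γ j + rmin) := by
    funext t
    rw [← Finset.add_sum_erase _ _ (Finset.mem_univ i), Function.update_self]
    congr 1
    refine Finset.sum_congr rfl fun j hj => ?_
    rw [Function.update_of_ne (Finset.ne_of_mem_erase hj)]
  rw [errorPartial, heq.deriv_eq, hsum, deriv_add_const, deriv_comp_add_const]

theorem IsAdmissible.errorHess_zero (hS : S.IsAdmissible) (hobs : S.IsNetObservable 0)
    (hγ : ∀ i, 0 < γ i + rmin) (i j : Fin N) :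
    S.errorHess rmin i j (0, γ) = if j = i then
      deriv (deriv (traceError (S.A i) (S.c i * (S.c i)ᵀ) (S.G i * (S.G i)ᵀ))) (γ i + rmin)
      else 0 := by
  have h := hobs.contDiffAt_error hS hγ
  have h1 : HasDerivAt (fun t : ℝ => ((0 : ℝ), Function.update γ j t))
      ((0 : ℝ), Pi.single j (1 : ℝ)) (γ j) :=
    (hasDerivAt_const (γ j) 0).prodMk (hasDerivAt_update γ j (γ j))
  have h2 : HasFDerivAt (fun z : ℝ × (Fin N → ℝ) => S.errorPartial z.1 rmin z.2 i)
      (fderiv ℝ (fun z : ℝ × (Fin N → ℝ) => S.errorPartial z.1 rmin z.2 i) (0, γ))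
      (0, Function.update γ j (γ j)) := by
    rw [Function.update_eq_self]
    exact ((contDiffAt_errorPartial i h).differentiableAt (by simp)).hasFDerivAt
  have h3 : deriv (fun t => S.errorPartial 0 rmin (Function.update γ j t) i) (γ j)
      = S.errorHess rmin i j (0, γ) := by
    have h4 := h2.comp_hasDerivAt (γ j) h1
    exact h4.deriv
  have heq : (fun t => S.errorPartial 0 rmin (Function.update γ j t) i) =ᶠ[nhds (γ j)]
      fun t => deriv (traceError (S.A i) (S.c i * (S.c i)ᵀ) (S.G i * (S.G i)ᵀ))
        (Function.update γ j t i + rmin) := by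
    filter_upwards [eventually_update_add_pos hγ j] with t ht
    exact hS.errorPartial_zero ht i
  rw [← h3, heq.deriv_eq]
  split_ifs with hij
  · subst hij
    simp only [Function.update_self]
    exact deriv_comp_add_const _ _ _
  · have : (fun t => deriv (traceError (S.A i) (S.c i * (S.c i)ᵀ) (S.G i * (S.G i)ᵀ))
        (Function.update γ j t i + rmin)) = fun _ =>
        deriv (traceError (S.A i) (S.c i * (S.c i)ᵀ) (S.G i * (S.G i)ᵀ)) (γ i + rmin) := by
      funext t
      rw [Function.update_of_ne (Ne.symm hij)]
    rw [this, deriv_const]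

/-- For weak coupling the Hessian of the error is close to a positive diagonal matrix. -/
theorem IsAdmissible.exists_eventually_hessian_bounds (hS : S.IsAdmissible) (hN : 0 < N)
    (hn : 0 < n) (hrmin : 0 < rmin) {σmax : ℝ} (hσ : 0 < σmax) :
    ∃ a δ : ℝ, 0 ≤ δ ∧ 4 * N * δ < a ∧ ∀ᶠ ε in nhds (0 : ℝ), S.IsNetObservable ε ∧
      ∀ γ ∈ Icc (0 : Fin N → ℝ) (fun _ => σmax), ∀ i,
        a ≤ S.errorHess rmin i i (ε, γ) ∧ ∀ j, j ≠ i → |S.errorHess rmin i j (ε, γ)| ≤ δ := by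
  have hNe : Nonempty (Fin N) := ⟨⟨0, hN⟩⟩
  have hobs0 := hS.eventually_isNetObservable.self_of_nhds
  have hpos : ∀ γ ∈ Icc (0 : Fin N → ℝ) (fun _ => σmax), ∀ i, 0 < γ i + rmin :=
    fun γ hγ i => add_pos_of_nonneg_of_pos (hγ.1 i) hrmin
  have hcont : ∀ γ ∈ Icc (0 : Fin N → ℝ) (fun _ => σmax), ∀ i j,
      ContinuousAt (S.errorHess rmin i j) (0, γ) := fun γ hγ i j =>
    continuousAt_errorHess i j (hobs0.contDiffAt_error hS (hpos γ hγ))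
  have hmin : ∀ i, ∃ b : ℝ, 0 < b ∧ ∀ γ ∈ Icc (0 : Fin N → ℝ) (fun _ => σmax),
      b ≤ S.errorHess rmin i i (0, γ) := by
    intro i
    obtain ⟨γ₀, hγ₀, hle⟩ := (isCompact_Icc (a := (0 : Fin N → ℝ)) (b := fun _ => σmax)).exists_isMinOn
      ⟨0, left_mem_Icc.2 fun _ => hσ.le⟩ (f := fun γ => S.errorHess rmin i i (0, γ))
      fun γ hγ => (ContinuousAt.comp (f := fun γ : Fin N → ℝ => ((0 : ℝ), γ)) (hcont γ hγ i i)
        (by fun_prop)).continuousWithinAt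
    refine ⟨S.errorHess rmin i i (0, γ₀), ?_, fun γ hγ => hle hγ⟩
    rw [hS.errorHess_zero hobs0 (hpos γ₀ hγ₀), if_pos rfl]
    exact (hS.traceError_regular hn i (hpos γ₀ hγ₀ i)).2
  choose b hb hbmin using hmin
  obtain ⟨i₀, hi₀⟩ := Finite.exists_min b
  have hN' : (0 : ℝ) < N := by exact_mod_cast hN
  -- `b i₀` bounds all diagonal entries from below at `ε = 0`. Half of it leaves room for
  -- perturbation, and the choice of `δ` gives `4 N δ = b i₀ / 4`.
  refine ⟨b i₀ / 2, b i₀ / (16 * N), div_nonneg (hb i₀).le (by positivity), ?_, ?_⟩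
  · have e : 4 * (N : ℝ) * (b i₀ / (16 * N)) = b i₀ / 4 := by field_simp; ring
    rw [e]; linarith [hb i₀]
  · refine hS.eventually_isNetObservable.and ?_
    refine isCompact_Icc.eventually_forall_of_forall_eventually fun γ hγ => ?_
    refine Filter.eventually_all.2 fun i => Filter.Eventually.and ?_ ?_
    · refine ((hcont γ hγ i i).eventually (lt_mem_nhds ?_)).mono fun z hz => le_of_lt hz
      linarith [hi₀ i, hbmin i γ hγ, hb i₀]
    · refine Filter.eventually_all.2 fun j => ?_
      by_cases hij : j = i
      · simp [hij]
      have h0 : S.errorHess rmin i j (0, γ) = 0 := by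
        rw [hS.errorHess_zero hobs0 (hpos γ hγ), if_neg hij]
      have hδ : 0 < b i₀ / (16 * N) := div_pos (hb i₀) (by positivity)
      have hlt : |S.errorHess rmin i j (0, γ)| < b i₀ / (16 * N) := by rwa [h0, abs_zero]
      exact ((hcont γ hγ i j).abs.tendsto.eventually (gt_mem_nhds hlt)).mono
        fun z hz _ => le_of_lt hz

end Network

/-! ### Optimal allocations for near-diagonal Hessians -/

section NearDiagonal

variable {N : ℕ}

/-- The Jacobian matrix of `g` on the cube `[0, σmax]^N` is close to a positive diagonal matrix. -/
structure IsNearDiagonal (g : (Fin N → ℝ) → Fin N → ℝ) (σmax a δ : ℝ) : Prop where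
  nonneg : 0 ≤ δ
  lt : 4 * N * δ < a
  contDiffAt : ∀ γ ∈ Icc (0 : Fin N → ℝ) (fun _ => σmax), ∀ i,
    ContDiffAt ℝ 1 (fun γ => g γ i) γ
  le_diag : ∀ γ ∈ Icc (0 : Fin N → ℝ) (fun _ => σmax), ∀ i,
    a ≤ fderiv ℝ (fun γ => g γ i) γ (Pi.single i 1)
  abs_le : ∀ γ ∈ Icc (0 : Fin N → ℝ) (fun _ => σmax), ∀ i j, j ≠ i →
    |fderiv ℝ (fun γ => g γ i) γ (Pi.single j 1)| ≤ δ

/-- The first order optimality conditions over the simplex of height `σ`, with multiplier `μ`. -/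
structure IsKKT (g : (Fin N → ℝ) → Fin N → ℝ) (σ μ : ℝ) (γ : Fin N → ℝ) : Prop where
  mem : γ ∈ heightSimplex N σ
  eq : ∀ i, 0 < γ i → g γ i = μ
  le : ∀ i, μ ≤ g γ i

/-- Comparison principle for near-diagonal linear maps. -/
theorem nearDiagonal_comparison {d D m : Fin N → ℝ} {a δ e : ℝ} (hδ : 0 ≤ δ) (ha : 4 * N * δ < a)
    (hm : ∀ i, a ≤ m i) (hD : ∀ i, |D i - m i * d i| ≤ δ * ∑ j, |d j|)
    (hpos : ∀ i, 0 < d i → D i ≤ e) (hneg : ∀ i, d i < 0 → e ≤ D i) (hsum : 0 ≤ ∑ i, d i)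
    (hd : d ≠ 0) : (∀ i, 0 ≤ d i) ∧ 0 < e ∧ ∀ i, d i = 0 → D i < e := by
  set s := ∑ j, |d j| with hs
  obtain ⟨i₁, hi₁⟩ := Function.ne_iff.1 hd
  have hspos : 0 < s := Finset.sum_pos' (fun _ _ => abs_nonneg _)
    ⟨i₁, Finset.mem_univ _, abs_pos.2 hi₁⟩
  have hNpos : (0 : ℝ) < N := by exact_mod_cast (Fin.pos i₁)
  have ha0 : 0 < a := lt_of_le_of_lt (by positivity) ha
  -- As `∑ d ≥ 0`, the average of `|d i| + d i` is at least `s / N`. An index reaching the average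
  -- has `d i > 0` and `2 N d i ≥ s`.
  obtain ⟨i, -, hi⟩ : ∃ i ∈ Finset.univ, s / N ≤ |d i| + d i := by
    refine Finset.exists_le_of_sum_le ⟨i₁, Finset.mem_univ _⟩ ?_
    rw [Finset.sum_const, Finset.card_univ, Fintype.card_fin, nsmul_eq_mul,
      mul_div_cancel₀ _ hNpos.ne', Finset.sum_add_distrib]
    linarith
  have hdi : 0 < d i := by
    by_contra! h
    rw [abs_of_nonpos h, neg_add_cancel] at hi
    exact absurd hi (not_le.2 (by positivity))
  rw [abs_of_pos hdi, div_le_iff₀ hNpos] at hi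
  -- At this index `e ≥ D i ≥ a d i - δ s > 4 N δ d i - δ s ≥ δ s`; this is where the factor 4 is
  -- used. At an index with `d j ≤ 0` the bound `D j ≤ δ s < e` then gives the remaining claims.
  have he : δ * s < e := by
    have h1 := (abs_le.1 (hD i)).1
    have h2 := hpos i hdi
    have h3 : a * d i ≤ m i * d i := mul_le_mul_of_nonneg_right (hm i) hdi.le
    have h4 : 4 * N * δ * d i < a * d i := mul_lt_mul_of_pos_right ha hdi
    have h5 : δ * s ≤ δ * ((d i + d i) * N) := mul_le_mul_of_nonneg_left hi hδ
    nlinarith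
  have hδs : 0 ≤ δ * s := mul_nonneg hδ hspos.le
  refine ⟨fun j => ?_, lt_of_le_of_lt hδs he, fun j hj => ?_⟩
  · by_contra! hj
    have h1 := (abs_le.1 (hD j)).2
    have h2 := hneg j hj
    have h3 : m j * d j < 0 := mul_neg_of_pos_of_neg (lt_of_lt_of_le ha0 (hm j)) hj
    linarith
  · have h1 := (abs_le.1 (hD j)).2
    rw [hj, mul_zero, sub_zero] at h1
    linarith

theorem abs_apply_sub_le {L : (Fin N → ℝ) →L[ℝ] ℝ} {δ : ℝ} (i : Fin N)
    (hL : ∀ j, j ≠ i → |L (Pi.single j 1)| ≤ δ) (hδ : 0 ≤ δ) (d : Fin N → ℝ) :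
    |L d - L (Pi.single i 1) * d i| ≤ δ * ∑ j, |d j| := by
  have e : L d = ∑ j, d j * L (Pi.single j 1) := by
    conv_lhs => rw [pi_eq_sum_univ' d, map_sum]
    refine Finset.sum_congr rfl fun j _ => ?_
    rw [map_smul, smul_eq_mul]
  rw [e, ← Finset.add_sum_erase _ _ (Finset.mem_univ i), mul_comm (d i), add_sub_cancel_left,
    Finset.mul_sum]
  refine (Finset.abs_sum_le_sum_abs _ _).trans ?_
  refine (Finset.sum_le_sum fun j hj => ?_).trans (Finset.sum_le_sum_of_subset_of_nonneg
    (Finset.erase_subset i Finset.univ) fun j _ _ => mul_nonneg hδ (abs_nonneg _))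
  rw [abs_mul, mul_comm]
  exact mul_le_mul_of_nonneg_right (hL j (Finset.ne_of_mem_erase hj)) (abs_nonneg _)

theorem mem_cube_of_mem_heightSimplex {σ σmax : ℝ} (hσ : σ ≤ σmax) {γ : Fin N → ℝ}
    (h : γ ∈ heightSimplex N σ) : γ ∈ Icc (0 : Fin N → ℝ) (fun _ => σmax) := by
  refine ⟨h.1, fun i => le_trans ?_ hσ⟩
  rw [← h.2]
  exact Finset.single_le_sum (f := γ) (fun j _ => h.1 j) (Finset.mem_univ i)

variable {g : (Fin N → ℝ) → Fin N → ℝ} {σmax a δ : ℝ}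

/-- The intermediate point depends on the component `i`, so the comparison principle is stated with
increments and diagonal slopes instead of a single Jacobian. -/
theorem IsNearDiagonal.exists_mean_value (hg : IsNearDiagonal g σmax a δ) {γ γ' : Fin N → ℝ}
    (h : γ ∈ Icc (0 : Fin N → ℝ) (fun _ => σmax)) (h' : γ' ∈ Icc (0 : Fin N → ℝ) (fun _ => σmax))
    (i : Fin N) : ∃ m, a ≤ m ∧
      |(g γ' i - g γ i) - m * (γ' i - γ i)| ≤ δ * ∑ j, |γ' j - γ j| := by
  obtain ⟨ξ, hξ, e⟩ := domain_mvt (f := fun γ => g γ i) (f' := fun ξ => fderiv ℝ (fun γ => g γ i) ξ)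
    (fun ξ hξ => ((hg.contDiffAt ξ hξ i).differentiableAt one_ne_zero).hasFDerivAt.hasFDerivWithinAt)
    (convex_Icc (0 : Fin N → ℝ) fun _ => σmax) h h'
  have hξ' := (convex_Icc (0 : Fin N → ℝ) fun _ => σmax).segment_subset h h' hξ
  refine ⟨_, hg.le_diag ξ hξ' i, ?_⟩
  have := abs_apply_sub_le i (hg.abs_le ξ hξ' i) hg.nonneg (γ' - γ)
  rw [← e] at this
  exact this

/-- Complementary slackness supplies the sign conditions: where `γ' i > γ i`, the index is active
for `γ'`, so `g γ' i = μ'` while `g γ i ≥ μ`; symmetrically where `γ' i < γ i`. -/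
theorem IsNearDiagonal.kkt_comparison (hg : IsNearDiagonal g σmax a δ) {σ σ' μ μ' : ℝ}
    {γ γ' : Fin N → ℝ} (h : IsKKT g σ μ γ) (h' : IsKKT g σ' μ' γ') (hσ : σ ≤ σ')
    (hσ' : σ' ≤ σmax) (hne : γ ≠ γ') :
    γ ≤ γ' ∧ μ < μ' ∧ ∀ j, γ' j = γ j → g γ' j - g γ j < μ' - μ := by
  choose m hm hmD using hg.exists_mean_value (mem_cube_of_mem_heightSimplex (hσ.trans hσ') h.mem)
    (mem_cube_of_mem_heightSimplex hσ' h'.mem)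
  obtain ⟨h1, h2, h3⟩ := nearDiagonal_comparison (d := fun i => γ' i - γ i)
    (D := fun i => g γ' i - g γ i) (e := μ' - μ) hg.nonneg hg.lt hm hmD
    (fun i hi => by
      have := h.mem.1 i
      have := h'.eq i (by linarith)
      have := h.le i
      linarith)
    (fun i hi => by
      have := h'.mem.1 i
      have := h.eq i (by linarith)
      have := h'.le i
      linarith)
    (by rw [Finset.sum_sub_distrib, h.mem.2, h'.mem.2]; linarith)
    (fun h0 => hne (funext fun i => (sub_eq_zero.1 (congrFun h0 i)).symm))
  exact ⟨fun i => sub_nonneg.1 (h1 i), sub_pos.1 h2, fun j hj => h3 j (sub_eq_zero.2 hj)⟩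

theorem IsNearDiagonal.kkt_mono (hg : IsNearDiagonal g σmax a δ) {σ σ' μ μ' : ℝ}
    {γ γ' : Fin N → ℝ} (h : IsKKT g σ μ γ) (h' : IsKKT g σ' μ' γ') (hσ : σ ≤ σ')
    (hσ' : σ' ≤ σmax) : γ ≤ γ' := by
  by_cases hne : γ = γ'
  · exact hne.le
  · exact (hg.kkt_comparison h h' hσ hσ' hne).1

theorem IsNearDiagonal.kkt_unique (hg : IsNearDiagonal g σmax a δ) {σ μ μ' : ℝ}
    {γ γ' : Fin N → ℝ} (h : IsKKT g σ μ γ) (h' : IsKKT g σ μ' γ') (hσ : σ ≤ σmax) : γ = γ' :=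
  le_antisymm (hg.kkt_mono h h' le_rfl hσ) (hg.kkt_mono h' h le_rfl hσ)

/-- If `γ' j` were zero, `g` would grow at `j` by strictly less than the multiplier does, so that `g
γ' j < μ'`, against optimality. -/
theorem IsNearDiagonal.pos_of_tight (hg : IsNearDiagonal g σmax a δ) {σ σ' μ μ' : ℝ}
    {γ γ' : Fin N → ℝ} (h : IsKKT g σ μ γ) (h' : IsKKT g σ' μ' γ') (hσ : σ < σ')
    (hσ' : σ' ≤ σmax) {j : Fin N} (hj : g γ j = μ) : 0 < γ' j := by
  obtain ⟨h1, -, h3⟩ := hg.kkt_comparison h h' hσ.le hσ' (by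
    rintro rfl
    exact hσ.ne (h.mem.2.symm.trans h'.mem.2))
  refine lt_of_le_of_ne (h'.mem.1 j) fun h0 => ?_
  have h4 : γ j = 0 := le_antisymm ((h1 j).trans h0.ge) (h.mem.1 j)
  have h5 := h3 j (by rw [h4, ← h0])
  have h6 := h'.le j
  linarith

variable {f : ℝ → Fin N → ℝ}

/-- `f` is a path of optimality points over the simplices of height `σ ∈ [0, σmax]`. -/
def IsKKTPath (g : (Fin N → ℝ) → Fin N → ℝ) (σmax : ℝ) (f : ℝ → Fin N → ℝ) : Prop :=
  ∀ σ ∈ Icc 0 σmax, ∃ μ, IsKKT g σ μ (f σ)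

theorem IsKKTPath.monotoneOn (hf : IsKKTPath g σmax f) (hg : IsNearDiagonal g σmax a δ) :
    MonotoneOn f (Icc 0 σmax) := by
  intro σ h σ' h' hle
  obtain ⟨μ, hμ⟩ := hf σ h
  obtain ⟨μ', hμ'⟩ := hf σ' h'
  exact hg.kkt_mono hμ hμ' hle h'.2

theorem IsKKTPath.supp_mono (hf : IsKKTPath g σmax f) (hg : IsNearDiagonal g σmax a δ) :
    MonotoneOn (fun σ => {i | 0 < f σ i}) (Icc 0 σmax) := fun _ h _ h' hle i hi =>
  lt_of_lt_of_le hi (hf.monotoneOn hg h h' hle i)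

/-- The entries are nondecreasing and their increments add up to `σ' - σ`, so each is at most `σ' -
σ` and the path is 1-Lipschitz in the sup norm. -/
theorem IsKKTPath.continuousOn (hf : IsKKTPath g σmax f) (hg : IsNearDiagonal g σmax a δ) :
    ContinuousOn f (Icc 0 σmax) := by
  have key : ∀ σ ∈ Icc 0 σmax, ∀ σ' ∈ Icc 0 σmax, σ ≤ σ' → ∀ i, f σ' i - f σ i ≤ σ' - σ := by
    intro σ h σ' h' hle i
    obtain ⟨μ, hμ⟩ := hf σ h
    obtain ⟨μ', hμ'⟩ := hf σ' h'
    have e : ∑ i, (f σ' i - f σ i) = σ' - σ := by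
      rw [Finset.sum_sub_distrib, hμ.mem.2, hμ'.mem.2]
    rw [← e]
    exact Finset.single_le_sum (f := fun i => f σ' i - f σ i)
      (fun j _ => sub_nonneg.2 (hf.monotoneOn hg h h' hle j)) (Finset.mem_univ i)
  have hL : LipschitzOnWith 1 f (Icc 0 σmax) := by
    refine LipschitzOnWith.of_dist_le_mul fun σ h σ' h' => ?_
    rw [NNReal.coe_one, one_mul, dist_pi_le_iff dist_nonneg]
    intro i
    rcases le_total σ σ' with hle | hle
    · rw [dist_comm, dist_comm σ, Real.dist_eq, Real.dist_eq, abs_of_nonneg (sub_nonneg.2 hle),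
        abs_of_nonneg (sub_nonneg.2 (hf.monotoneOn hg h h' hle i))]
      exact key σ h σ' h' hle i
    · rw [Real.dist_eq, Real.dist_eq, abs_of_nonneg (sub_nonneg.2 hle),
        abs_of_nonneg (sub_nonneg.2 (hf.monotoneOn hg h' h hle i))]
      exact key σ' h' σ h hle i
  exact hL.continuousOn

theorem IsKKTPath.exists_pos (hf : IsKKTPath g σmax f) {σ : ℝ} (hσ : σ ∈ Icc 0 σmax)
    (h0 : 0 < σ) : ∃ k, 0 < f σ k := by
  obtain ⟨μ, hμ⟩ := hf σ hσ
  by_contra! h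
  have := Finset.sum_nonpos fun i (_ : i ∈ Finset.univ) => h i
  rw [hμ.mem.2] at this
  linarith

theorem IsKKTPath.zero (hf : IsKKTPath g σmax f) (hσ : 0 ≤ σmax) (i : Fin N) : f 0 i = 0 := by
  obtain ⟨μ, hμ⟩ := hf 0 (left_mem_Icc.2 hσ)
  exact (Finset.sum_eq_zero_iff_of_nonneg fun j _ => hμ.mem.1 j).1 hμ.mem.2 i (Finset.mem_univ i)

/-- The heights at which an index outside of the support is tight. -/
def kktBreakpoints (g : (Fin N → ℝ) → Fin N → ℝ) (σmax : ℝ) (f : ℝ → Fin N → ℝ) : Set ℝ :=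
  {σ | σ ∈ Icc 0 σmax ∧ ∃ μ, IsKKT g σ μ (f σ) ∧ {i | 0 < f σ i} ⊂ {i | g (f σ) i = μ}} ∪
    {0, σmax}

theorem kktBreakpoints_subset (hσ : 0 ≤ σmax) : kktBreakpoints g σmax f ⊆ Icc 0 σmax := by
  rintro σ (h | rfl | rfl)
  exacts [h.1, left_mem_Icc.2 hσ, right_mem_Icc.2 hσ]

/-- An index enters the support only at a breakpoint. -/
theorem IsKKTPath.exists_breakpoint (hf : IsKKTPath g σmax f) (hg : IsNearDiagonal g σmax a δ)
    {σ₁ σ₂ : ℝ} (h1 : 0 < σ₁) (h12 : σ₁ ≤ σ₂) (h2 : σ₂ ≤ σmax) {i : Fin N} (hi₁ : ¬ 0 < f σ₁ i)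
    (hi₂ : 0 < f σ₂ i) : ∃ τ ∈ Ico σ₁ σ₂, τ ∈ kktBreakpoints g σmax f := by
  have hsub : Icc σ₁ σ₂ ⊆ Icc 0 σmax := Icc_subset_Icc h1.le h2
  have hcont := (hf.continuousOn hg).mono hsub
  have hcpt : IsCompact (Icc σ₁ σ₂ ∩ (fun σ => f σ i) ⁻¹' Iic 0) :=
    isCompact_Icc.of_isClosed_subset (((continuous_apply i).comp_continuousOn
      hcont).preimage_isClosed_of_isClosed isClosed_Icc isClosed_Iic) inter_subset_left
  -- `τ` is the last height at which `i` is inactive. Just after it, `i` is active along with any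
  -- `k` already active at `τ`, so their partial derivatives agree, also in the limit: `i` is tight
  -- but inactive at `τ`.
  obtain ⟨τ, ⟨hτ, hτ0⟩, hmax⟩ := hcpt.exists_isGreatest ⟨σ₁, left_mem_Icc.2 h12, not_lt.1 hi₁⟩
  have hτ0 : f τ i ≤ 0 := hτ0
  have hτ2 : τ < σ₂ := lt_of_le_of_ne hτ.2 (by rintro rfl; exact absurd hi₂ (not_lt.2 hτ0))
  have hτpos : 0 < τ := h1.trans_le hτ.1
  obtain ⟨k, hk⟩ := hf.exists_pos (hsub hτ) hτpos
  obtain ⟨μ, hμ⟩ := hf τ (hsub hτ)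
  have hIoc : Ioc τ σ₂ ∈ nhdsWithin τ (Ioi τ) := Ioc_mem_nhdsGT hτ2
  have hlim : Filter.Tendsto f (nhdsWithin τ (Ioi τ)) (nhds (f τ)) := by
    refine (hcont τ hτ).mono_left (nhdsWithin_le_of_mem ?_)
    exact Filter.mem_of_superset hIoc (Ioc_subset_Icc_self.trans (Icc_subset_Icc_left hτ.1))
  have hgc : ∀ l, Filter.Tendsto (fun σ => g (f σ) l) (nhdsWithin τ (Ioi τ)) (nhds (g (f τ) l)) :=
    fun l => Filter.Tendsto.comp (hg.contDiffAt (f τ)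
      (mem_cube_of_mem_heightSimplex (hsub hτ).2 hμ.mem) l).continuousAt hlim
  have heq : (fun σ => g (f σ) i) =ᶠ[nhdsWithin τ (Ioi τ)] fun σ => g (f σ) k := by
    filter_upwards [hIoc] with σ hσ
    have hσ' : σ ∈ Icc σ₁ σ₂ := ⟨hτ.1.trans hσ.1.le, hσ.2⟩
    obtain ⟨ν, hν⟩ := hf σ (hsub hσ')
    have hiσ : 0 < f σ i := by
      by_contra! h
      exact absurd (hmax ⟨hσ', h⟩) (not_le.2 hσ.1)
    rw [hν.eq i hiσ, hν.eq k (hf.supp_mono hg (hsub hτ) (hsub hσ') hσ.1.le hk)]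
  have hik : g (f τ) i = g (f τ) k := tendsto_nhds_unique ((hgc i).congr' heq) (hgc k)
  refine ⟨τ, ⟨hτ.1, hτ2⟩, Or.inl ⟨hsub hτ, μ, hμ, ⟨fun l hl => hμ.eq l hl, fun h => ?_⟩⟩⟩
  have hi : i ∈ {i | g (f τ) i = μ} := hik.trans (hμ.eq k hk)
  exact absurd (h hi) (not_lt.2 hτ0)

/-- At a breakpoint the tight set strictly contains the support, and `IsNearDiagonal.pos_of_tight`
places it inside every later support. At height 0 the support is empty. -/
theorem IsKKTPath.supp_strictMono (hf : IsKKTPath g σmax f) (hg : IsNearDiagonal g σmax a δ)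
    (hσmax : 0 ≤ σmax) {σ σ' : ℝ} (hσ : σ ∈ kktBreakpoints g σmax f) (hσ' : σ' ∈ Icc 0 σmax)
    (hlt : σ < σ') : {i | 0 < f σ i} ⊂ {i | 0 < f σ' i} := by
  rcases hσ with ⟨hσ, μ, hμ, hss⟩ | rfl | rfl
  · obtain ⟨μ', hμ'⟩ := hf σ' hσ'
    exact hss.trans_subset fun j hj => hg.pos_of_tight hμ hμ' hlt hσ'.2 hj
  · obtain ⟨k, hk⟩ := hf.exists_pos hσ' hlt
    refine ⟨fun i hi => ?_, fun h => ?_⟩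
    · have hi : 0 < f 0 i := hi
      rw [hf.zero hσmax] at hi
      exact absurd hi (lt_irrefl _)
    · have : 0 < f 0 k := h hk
      rw [hf.zero hσmax] at this
      exact absurd this (lt_irrefl _)
  · exact absurd hσ'.2 (not_le.2 hlt)

/-- The support is injective on breakpoints, and there are finitely many subsets of indices. -/
theorem IsKKTPath.finite_breakpoints (hf : IsKKTPath g σmax f) (hg : IsNearDiagonal g σmax a δ)
    (hσmax : 0 ≤ σmax) : (kktBreakpoints g σmax f).Finite := by
  have hsub := kktBreakpoints_subset (g := g) (f := f) hσmax
  refine Set.Finite.of_injOn (f := fun σ => {i | 0 < f σ i}) (t := Set.univ)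
    (fun _ _ => mem_univ _) (fun σ h σ' h' heq => ?_) finite_univ
  rcases lt_trichotomy σ σ' with hlt | rfl | hlt
  · exact absurd heq (hf.supp_strictMono hg hσmax h (hsub h') hlt).ne
  · rfl
  · exact absurd heq.symm (hf.supp_strictMono hg hσmax h' (hsub h) hlt).ne

theorem IsKKTPath.supp_eq (hf : IsKKTPath g σmax f) (hg : IsNearDiagonal g σmax a δ) {σ₁ σ₂ σ : ℝ}
    (h1 : 0 ≤ σ₁) (h2 : σ₂ ≤ σmax) (hno : ∀ τ ∈ Ioo σ₁ σ₂, τ ∉ kktBreakpoints g σmax f)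
    (hσ : σ ∈ Ioc σ₁ σ₂) : {i | 0 < f σ i} = {i | 0 < f σ₂ i} := by
  have hσ0 : 0 < σ := h1.trans_lt hσ.1
  refine Subset.antisymm (hf.supp_mono hg ⟨hσ0.le, hσ.2.trans h2⟩
    ⟨(hσ0.trans_le hσ.2).le, h2⟩ hσ.2) fun i hi => ?_
  by_contra hni
  obtain ⟨τ, hτ, hτb⟩ := hf.exists_breakpoint hg hσ0 hσ.2 h2 hni hi
  exact hno τ ⟨hσ.1.trans_le hτ.1, hτ.2⟩ hτb

/-- The path is continuously differentiable where its support is locally constant. -/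
theorem IsKKTPath.contDiffAt (hf : IsKKTPath g σmax f) (hg : IsNearDiagonal g σmax a δ) {σ₀ : ℝ}
    (hσ₀ : σ₀ ∈ Ioo 0 σmax) (hI : ∀ᶠ σ in nhds σ₀, {i | 0 < f σ i} = {i | 0 < f σ₀ i}) :
    ContDiffAt ℝ 1 f σ₀ := by
  classical
  have hnhds : Icc 0 σmax ∈ nhds σ₀ := Icc_mem_nhds hσ₀.1 hσ₀.2
  obtain ⟨k, hk⟩ := hf.exists_pos (Ioo_subset_Icc_self hσ₀) hσ₀.1
  obtain ⟨μ₀, hμ₀⟩ := hf σ₀ (Ioo_subset_Icc_self hσ₀)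
  have hcube := mem_cube_of_mem_heightSimplex hσ₀.2.le hμ₀.mem
  have hgd := hg.contDiffAt (f σ₀) hcube
  set Dg : Fin N → (Fin N → ℝ) →L[ℝ] ℝ := fun i => fderiv ℝ (fun γ => g γ i) (f σ₀)
  have hDg : ∀ i, HasFDerivAt (fun γ => g γ i) (Dg i) (f σ₀) := fun i =>
    ((hgd i).differentiableAt one_ne_zero).hasFDerivAt
  set pr : Fin N → (Fin N → ℝ) →L[ℝ] ℝ := fun i => ContinuousLinearMap.proj i
  have hpr : ∀ i, HasFDerivAt (fun γ : Fin N → ℝ => γ i) (pr i) (f σ₀) := fun i =>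
    (pr i).hasFDerivAt
  -- A square system for the path: row `k` records the height, active rows equate partial
  -- derivatives with that of `k`, inactive rows record `γ i`. Along the path its value is
  -- `Pi.single k σ`.
  set F : (Fin N → ℝ) → Fin N → ℝ := fun γ i =>
    if i = k then ∑ j, γ j else if 0 < f σ₀ i then g γ i - g γ k else γ i with hF
  set F' : (Fin N → ℝ) →L[ℝ] (Fin N → ℝ) := ContinuousLinearMap.pi fun i =>
    if i = k then ∑ j, pr j else if 0 < f σ₀ i then Dg i - Dg k else pr i with hF'
  have hFC : ContDiffAt ℝ 1 F (f σ₀) := by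
    refine contDiffAt_pi.2 fun i => ?_
    simp only [hF]
    split_ifs
    · fun_prop
    · exact (hgd i).sub (hgd k)
    · fun_prop
  have hFD : HasFDerivAt F F' (f σ₀) := by
    refine hasFDerivAt_pi.2 fun i => ?_
    split_ifs
    · exact HasFDerivAt.fun_sum fun j _ => hpr j
    · exact (hDg i).sub (hDg k)
    · exact hpr i
  have hinj : Function.Injective F' := by
    refine (injective_iff_map_eq_zero _).2 fun d hd => ?_
    have hcomp : ∀ i, (if i = k then ∑ j, d j else if 0 < f σ₀ i then Dg i d - Dg k d else d i)
        = 0 := by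
      intro i
      have h0 : F' d i = 0 := congrFun hd i
      refine Eq.trans ?_ h0
      simp only [hF', ContinuousLinearMap.pi_apply]
      split_ifs <;> simp [pr]
    have hsum : ∑ j, d j = 0 := by simpa using hcomp k
    have hin : ∀ i, d i ≠ 0 → Dg i d = Dg k d := by
      intro i hi
      have := hcomp i
      split_ifs at this with h1 h2
      · rw [h1]
      · exact sub_eq_zero.1 this
      · exact absurd this hi
    -- The comparison principle with `e = Dg k d` makes a nonzero kernel vector entrywise
    -- nonnegative; having sum zero, it vanishes.
    by_contra hne
    obtain ⟨h1, -, -⟩ := nearDiagonal_comparison (d := d) (D := fun i => Dg i d) (e := Dg k d)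
      hg.nonneg hg.lt (hg.le_diag _ hcube)
      (fun i => abs_apply_sub_le i (hg.abs_le _ hcube i) hg.nonneg d)
      (fun i hi => (hin i hi.ne').le) (fun i hi => (hin i hi.ne).ge) hsum.ge hne
    exact hne (funext fun i =>
      (Finset.sum_eq_zero_iff_of_nonneg fun j _ => h1 j).1 hsum i (Finset.mem_univ i))
  set L := (LinearEquiv.ofInjectiveEndo F'.toLinearMap hinj).toContinuousLinearEquiv
  have hL : HasFDerivAt F (L : (Fin N → ℝ) →L[ℝ] (Fin N → ℝ)) (f σ₀) := hFD
  have hleft := (hFC.hasStrictFDerivAt' hL one_ne_zero).eventually_left_inverse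
  have hfc : ContinuousAt f σ₀ := (hf.continuousOn hg).continuousAt hnhds
  have hval : ∀ᶠ σ in nhds σ₀, F (f σ) = Pi.single k σ := by
    filter_upwards [hI, hnhds] with σ hσI hσ
    obtain ⟨μ, hμ⟩ := hf σ hσ
    have hmem : ∀ i, 0 < f σ i ↔ 0 < f σ₀ i := fun i => Set.ext_iff.1 hσI i
    ext i
    simp only [hF, Pi.single_apply]
    split_ifs with h1 h2
    · exact hμ.mem.2
    · rw [hμ.eq i ((hmem i).2 h2), hμ.eq k ((hmem k).2 hk), sub_self]
    · exact le_antisymm (not_lt.1 (mt (hmem i).1 h2)) (hμ.mem.1 i)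
  have heq : f =ᶠ[nhds σ₀] fun σ => hFC.localInverse hL one_ne_zero (Pi.single k σ) := by
    filter_upwards [hfc.eventually hleft, hval] with σ h1 h2
    rw [← h2]
    exact h1.symm
  refine ContDiffAt.congr_of_eventuallyEq ?_ heq
  have hsingle : ContDiff ℝ 1 fun σ : ℝ => (Pi.single k σ : Fin N → ℝ) :=
    (ContinuousLinearMap.single ℝ (fun _ : Fin N => ℝ) k).contDiff
  refine ContDiffAt.comp (f := fun σ : ℝ => (Pi.single k σ : Fin N → ℝ)) σ₀ ?_ hsingle.contDiffAt
  have := hFC.to_localInverse hL one_ne_zero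
  rwa [hval.self_of_nhds] at this

/-- Minimizers over the simplex satisfy the first order optimality conditions. -/
theorem exists_isKKT_of_isMinOn (hN : 0 < N) {η : (Fin N → ℝ) → ℝ} {σ : ℝ} {γ : Fin N → ℝ}
    (hη : DifferentiableAt ℝ η γ) (hg : ∀ i, fderiv ℝ η γ (Pi.single i 1) = g γ i)
    (hγ : γ ∈ heightSimplex N σ) (hmin : IsMinOn η (heightSimplex N σ) γ) :
    ∃ μ, IsKKT g σ μ γ := by
  have hle : ∀ i j, 0 < γ i → g γ i ≤ g γ j := by
    intro i j hi
    -- Moving mass `t` from an active index `i` to `j` stays in the simplex, so the derivative in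
    -- that direction is nonnegative at a minimizer.
    have hmem : ∀ t ∈ Icc 0 (γ i), γ + t • (Pi.single j 1 - Pi.single i 1) ∈ heightSimplex N σ := by
      intro t ht
      refine ⟨fun l => ?_, ?_⟩
      · have h1 := hγ.1 l
        have h2 : (0 : ℝ) ≤ (Pi.single j 1 : Fin N → ℝ) l := by
          rw [Pi.single_apply]; split_ifs <;> norm_num
        have h3 : t * (Pi.single i 1 : Fin N → ℝ) l ≤ γ l := by
          rw [Pi.single_apply]; split_ifs with h
          · rw [h, mul_one]; exact ht.2
          · rw [mul_zero]; exact h1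
        simp only [Pi.add_apply, Pi.smul_apply, Pi.sub_apply, smul_eq_mul]
        nlinarith [mul_nonneg ht.1 h2]
      · simp [Finset.sum_add_distrib, ← Finset.mul_sum, Finset.sum_sub_distrib, hγ.2]
    have htan : γ i • (Pi.single j 1 - Pi.single i 1 : Fin N → ℝ) ∈
        posTangentConeAt (heightSimplex N σ) γ := by
      have := mem_posTangentConeAt_of_segment_subset (s := heightSimplex N σ) (x := γ)
        (y := γ i • (Pi.single j 1 - Pi.single i 1)) (by
          rw [segment_eq_image']
          rintro _ ⟨θ, hθ, rfl⟩
          simp only [add_sub_cancel_left, smul_smul]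
          exact hmem _ ⟨mul_nonneg hθ.1 hi.le, mul_le_of_le_one_left hi.le hθ.2⟩)
      exact this
    have := hmin.localize.hasFDerivWithinAt_nonneg hη.hasFDerivAt.hasFDerivWithinAt htan
    rw [map_smul, map_sub, hg, hg, smul_eq_mul] at this
    exact sub_nonneg.1 (nonneg_of_mul_nonneg_right this hi)
  have : Nonempty (Fin N) := ⟨⟨0, hN⟩⟩
  obtain ⟨j₀, hj₀⟩ := Finite.exists_min (g γ)
  exact ⟨g γ j₀, hγ, fun i hi => le_antisymm (hle i j₀ hi) (hj₀ i), hj₀⟩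

theorem isCompact_heightSimplex (σ : ℝ) : IsCompact (heightSimplex N σ) := by
  refine (isCompact_Icc (a := (0 : Fin N → ℝ)) (b := fun _ => σ)).of_isClosed_subset ?_
    fun γ hγ => mem_cube_of_mem_heightSimplex le_rfl hγ
  simp only [heightSimplex, ofPred_and, ofPred_forall]
  exact (isClosed_iInter fun i => isClosed_le (by fun_prop) (by fun_prop)).inter
    (isClosed_eq (by fun_prop) (by fun_prop))

theorem heightSimplex_nonempty (hN : 0 < N) {σ : ℝ} (hσ : 0 ≤ σ) : (heightSimplex N σ).Nonempty := by
  refine ⟨Pi.single ⟨0, hN⟩ σ, fun i => ?_, by simp⟩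
  rw [Pi.single_apply]
  split_ifs
  exacts [hσ, le_rfl]

end NearDiagonal

/-- Increasing enumeration of a finite set of reals from its least to its greatest element. -/
theorem exists_strictMono_enumeration {D : Set ℝ} (hD : D.Finite) {a b : ℝ} (ha : IsLeast D a)
    (hb : IsGreatest D b) : ∃ (m : ℕ) (s : Fin (m + 1) → ℝ),
      StrictMono s ∧ s 0 = a ∧ s (Fin.last m) = b ∧ D = range s := by
  have hne : hD.toFinset.Nonempty := ⟨a, hD.mem_toFinset.2 ha.1⟩
  obtain ⟨m, hm⟩ := Nat.exists_eq_succ_of_ne_zero (Finset.card_pos.2 hne).ne'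
  set s := hD.toFinset.orderEmbOfFin hm
  have hrange : D = range s := by rw [Finset.range_orderEmbOfFin, hD.coe_toFinset]
  have hmem : ∀ i, s i ∈ D := fun i => hrange ▸ mem_range_self i
  refine ⟨m, s, s.strictMono, ?_, ?_, hrange⟩
  · obtain ⟨i, hi⟩ := hrange ▸ ha.1
    exact le_antisymm (hi ▸ s.monotone (Fin.zero_le i)) (ha.2 (hmem 0))
  · obtain ⟨i, hi⟩ := hrange ▸ hb.1
    exact le_antisymm (hb.2 (hmem _)) (hi ▸ s.monotone (Fin.le_last i))

/-! ### The optimal allocation of a weakly coupled network -/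

namespace Network

variable {N n p : ℕ} {S : Network N n p} {rmin ε σmax a δ : ℝ}

theorem IsNetObservable.isNearDiagonal (hobs : S.IsNetObservable ε) (hS : S.IsAdmissible)
    (hrmin : 0 < rmin) (hδ : 0 ≤ δ) (ha : 4 * N * δ < a)
    (h : ∀ γ ∈ Icc (0 : Fin N → ℝ) (fun _ => σmax), ∀ i,
      a ≤ S.errorHess rmin i i (ε, γ) ∧ ∀ j, j ≠ i → |S.errorHess rmin i j (ε, γ)| ≤ δ) :
    IsNearDiagonal (S.errorPartial ε rmin) σmax a δ := by
  have hC := fun (γ : Fin N → ℝ) (hγ : γ ∈ Icc (0 : Fin N → ℝ) (fun _ => σmax)) =>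
    hobs.contDiffAt_error hS fun i => add_pos_of_nonneg_of_pos (hγ.1 i) hrmin
  refine ⟨hδ, ha, fun γ hγ i => ?_, fun γ hγ i => ?_, fun γ hγ i j hij => ?_⟩
  · have h1 := (contDiffAt_errorPartial i (hC γ hγ)).of_le (m := 1) (by exact_mod_cast le_top)
    exact ContDiffAt.comp (f := fun γ : Fin N → ℝ => (ε, γ)) γ h1 (by fun_prop)
  · rw [fderiv_errorPartial_single i i (hC γ hγ)]
    exact (h γ hγ i).1
  · rw [fderiv_errorPartial_single i j (hC γ hγ)]
    exact (h γ hγ i).2 j hij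

theorem IsNetObservable.differentiableAt_error (hobs : S.IsNetObservable ε) (hS : S.IsAdmissible)
    (hrmin : 0 < rmin) {γ : Fin N → ℝ} (hγ : ∀ i, 0 ≤ γ i) :
    DifferentiableAt ℝ (S.error ε rmin) γ := by
  have h := hobs.contDiffAt_error hS fun i => add_pos_of_nonneg_of_pos (hγ i) hrmin
  exact DifferentiableAt.comp (f := fun γ : Fin N → ℝ => (ε, γ)) γ
    (h.differentiableAt (by simp)) (by fun_prop)

theorem IsNetObservable.exists_isKKT (hobs : S.IsNetObservable ε) (hS : S.IsAdmissible)
    (hN : 0 < N) (hrmin : 0 < rmin) {σ : ℝ} {γ : Fin N → ℝ} (h : S.IsOptimal ε rmin σ γ) :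
    ∃ μ, IsKKT (S.errorPartial ε rmin) σ μ γ :=
  exists_isKKT_of_isMinOn hN (hobs.differentiableAt_error hS hrmin h.1.1)
    (fun i => fderiv_error_single i
      (hobs.contDiffAt_error hS fun i => add_pos_of_nonneg_of_pos (h.1.1 i) hrmin)) h.1 h.2

/-- Existence is compactness; uniqueness comes from comparing optimality points of equal height in
both directions. -/
theorem IsNetObservable.existsUnique_isOptimal (hobs : S.IsNetObservable ε) (hS : S.IsAdmissible)
    (hN : 0 < N) (hrmin : 0 < rmin) (hg : IsNearDiagonal (S.errorPartial ε rmin) σmax a δ) {σ : ℝ}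
    (hσ : σ ∈ Icc 0 σmax) : ∃! γ, S.IsOptimal ε rmin σ γ := by
  obtain ⟨γ, hγ, hmin⟩ := (isCompact_heightSimplex (N := N) σ).exists_isMinOn
    (heightSimplex_nonempty hN hσ.1) (f := S.error ε rmin) fun γ hγ =>
      (hobs.differentiableAt_error hS hrmin hγ.1).continuousAt.continuousWithinAt
  refine ⟨γ, ⟨hγ, hmin⟩, fun γ' hγ' => ?_⟩
  obtain ⟨μ, hμ⟩ := hobs.exists_isKKT hS hN hrmin ⟨hγ, hmin⟩
  obtain ⟨μ', hμ'⟩ := hobs.exists_isKKT hS hN hrmin hγ'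
  exact hg.kkt_unique hμ' hμ hσ.2

theorem isMultiplier_iff {σ μ : ℝ} (h : S.alloc ε rmin σ ∈ heightSimplex N σ) :
    S.IsMultiplier ε rmin σ μ ↔ IsKKT (S.errorPartial ε rmin) σ μ (S.alloc ε rmin σ) := by
  refine ⟨fun hμ => ⟨h, hμ.1, fun i => ?_⟩, fun hμ => ⟨hμ.eq, fun j _ => hμ.le j⟩⟩
  by_cases hi : i ∈ S.supp ε rmin σ
  · exact (hμ.1 i hi).ge
  · exact hμ.2 i hi

theorem breakpoints_eq
    (hf : IsKKTPath (S.errorPartial ε rmin) σmax (S.alloc ε rmin)) :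
    S.breakpoints ε rmin σmax =
      kktBreakpoints (S.errorPartial ε rmin) σmax (S.alloc ε rmin) := by
  refine congrArg (· ∪ {0, σmax}) (Set.ext fun σ => and_congr_right fun hσ =>
    exists_congr fun μ => and_congr_left fun _ => ?_)
  obtain ⟨ν, hν⟩ := hf σ hσ
  exact isMultiplier_iff hν.mem

end Network

theorem theorem2 {N n p : ℕ} (hN : 0 < N) (hn : 0 < n)
    (S : Network N n p) (hS : S.IsAdmissible)
    (rmin : ℝ) (hrmin : 0 < rmin) (σmax : ℝ) (hσmax : 0 < σmax) :
    ∃ ε₀ : ℝ, 0 < ε₀ ∧ ∀ ε : ℝ, |ε| ≤ ε₀ →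
      -- all the objects are well defined
      (∀ γ : Fin N → ℝ, (∀ i, 0 ≤ γ i) →
        (∃! X, S.IsCovariance ε rmin γ X) ∧ DifferentiableAt ℝ (S.error ε rmin) γ) ∧
      (∀ σ ∈ Set.Icc 0 σmax,
        (∃! γ, S.IsOptimal ε rmin σ γ) ∧ ∃ μ, S.IsMultiplier ε rmin σ μ) ∧
      -- the breakpoints are finitely many
      ∃ (m : ℕ) (s : Fin (m + 1) → ℝ),
        StrictMono s ∧ s 0 = 0 ∧ s (Fin.last m) = σmax ∧
        S.breakpoints ε rmin σmax = Set.range s ∧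
        -- the optimal allocation map
        ContinuousOn (S.alloc ε rmin) (Set.Icc 0 σmax) ∧
        MonotoneOn (S.alloc ε rmin) (Set.Icc 0 σmax) ∧
        (∀ i : Fin m, ContDiffOn ℝ 1 (S.alloc ε rmin) (Set.Ioo (s i.castSucc) (s i.succ))) ∧
        -- the support map
        MonotoneOn (S.supp ε rmin) (Set.Icc 0 σmax) ∧
        S.supp ε rmin (s 0) = ∅ ∧
        (∀ i : Fin m, S.supp ε rmin (s i.castSucc) ⊂ S.supp ε rmin (s i.succ)) ∧
        (∀ i : Fin m, ∀ σ ∈ Set.Ioc (s i.castSucc) (s i.succ),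
          S.supp ε rmin σ = S.supp ε rmin (s i.succ)) := by

  obtain ⟨a, δ, hδ, ha, hev⟩ := hS.exists_eventually_hessian_bounds hN hn hrmin hσmax
  obtain ⟨r, hr, hball⟩ := Metric.eventually_nhds_iff.1 hev
  -- Halving turns the open ball of radius `r` into the closed condition `|ε| ≤ ε₀`.
  refine ⟨r / 2, half_pos hr, fun ε hε => ?_⟩
  obtain ⟨hobs, hbounds⟩ := hball (y := ε) (by rw [Real.dist_0_eq_abs]; linarith)
  have hg := hobs.isNearDiagonal hS hrmin hδ ha hbounds
  have hopt : ∀ σ ∈ Icc 0 σmax, ∃! γ, S.IsOptimal ε rmin σ γ := fun σ hσ =>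
    hobs.existsUnique_isOptimal hS hN hrmin hg hσ
  have hf : IsKKTPath (S.errorPartial ε rmin) σmax (S.alloc ε rmin) := fun σ hσ =>
    hobs.exists_isKKT hS hN hrmin (Classical.epsilon_spec (hopt σ hσ).exists)
  refine ⟨fun γ hγ => ⟨hobs.existsUnique_isCovariance hS fun i =>
      add_pos_of_nonneg_of_pos (hγ i) hrmin, hobs.differentiableAt_error hS hrmin hγ⟩,
    fun σ hσ => ⟨hopt σ hσ, ?_⟩, ?_⟩
  · obtain ⟨μ, hμ⟩ := hf σ hσ
    exact ⟨μ, (Network.isMultiplier_iff hμ.mem).2 hμ⟩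
  rw [Network.breakpoints_eq hf]
  set D := Network.errorPartial S ε rmin with hD
  have hsub := kktBreakpoints_subset (g := D) (f := S.alloc ε rmin) hσmax.le
  obtain ⟨m, s, hs, hs0, hsm, hrange⟩ := exists_strictMono_enumeration
    (hf.finite_breakpoints hg hσmax.le) (a := 0) (b := σmax)
    ⟨Or.inr (Or.inl rfl), fun σ hσ => (hsub hσ).1⟩ ⟨Or.inr (Or.inr rfl), fun σ hσ => (hsub hσ).2⟩
  have hmem : ∀ i, s i ∈ kktBreakpoints D σmax (S.alloc ε rmin) := fun i =>
    hrange ▸ mem_range_self i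
  have hno : ∀ i : Fin m, ∀ τ ∈ Ioo (s i.castSucc) (s i.succ),
      τ ∉ kktBreakpoints D σmax (S.alloc ε rmin) := by
    intro i τ hτ hτD
    rw [hrange] at hτD
    obtain ⟨j, rfl⟩ := hτD
    have h1 := hs.lt_iff_lt.1 hτ.1
    have h2 := hs.lt_iff_lt.1 hτ.2
    exact absurd (Fin.castSucc_lt_iff_succ_le.1 h1) (not_le.2 h2)
  have hsupp : ∀ i : Fin m, ∀ σ ∈ Ioc (s i.castSucc) (s i.succ),
      S.supp ε rmin σ = S.supp ε rmin (s i.succ) := fun i σ hσ =>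
    hf.supp_eq hg (hsub (hmem _)).1 (hsub (hmem _)).2 (hno i) hσ
  refine ⟨m, s, hs, hs0, hsm, hrange, hf.continuousOn hg, hf.monotoneOn hg, fun i σ hσ => ?_,
    hf.supp_mono hg, ?_, fun i => ?_, hsupp⟩
  · refine (hf.contDiffAt hg ⟨(hsub (hmem _)).1.trans_lt hσ.1,
      hσ.2.trans_le (hsub (hmem _)).2⟩ ?_).contDiffWithinAt
    filter_upwards [Ioo_mem_nhds hσ.1 hσ.2] with τ hτ
    exact (hsupp i τ (Ioo_subset_Ioc_self hτ)).trans (hsupp i σ (Ioo_subset_Ioc_self hσ)).symm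
  · refine Set.eq_empty_of_forall_notMem fun i hi => ?_
    have hi : 0 < S.alloc ε rmin (s 0) i := hi
    rw [hs0, hf.zero hσmax.le] at hi
    exact lt_irrefl _ hi
  · exact hf.supp_strictMono hg hσmax.le (hmem _) (hsub (hmem _)) (hs i.castSucc_lt_succ)
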